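/- Let $k$ be a field and let $\mathrm{QCoh}(\mathbb{P}^1_k)$ be the category of quasicoherent sheaves on the projective line over $k$. A short exact sequence $0\to A\to B\to C\to 0$ in $\mathrm{QCoh}(\mathbb{P}^1_k)$ is called c-pure-exact if $0\to \mathrm{Hom}(F,A)\to \mathrm{Hom}(F,B)\to \mathrm{Hom}(F,C)\to 0$ is exact for every finitely presented object $F$ of $\mathrm{QCoh}(\mathbb{P}^1_k)$, that is, every $F$ for which $\mathrm{Hom}(F,-)$ commutes with direct limits. An object $N$ is c-pure-injective if $\mathrm{Hom}(-,N)$ sends c-pure-exact sequences to short exact sequences of abelian groups, and $\Sigma$-c-pure-injective if for every set $I$ the direct sum $N^{(I)}$ is c-pure-injective. Then the structure sheaf $\mathcal{O}_{\mathbb{P}^1_k}$ is $\Sigma$-c-pure-injective in $\mathrm{QCoh}(\mathbb{P}^1_k)$, and so is every line bundle on $\mathbb{P}^1_k$ (that is, every quasicoherent sheaf locally isomorphic to $\mathcal{O}_{\mathbb{P}^1_k}$; in particular every twist $\mathcal{O}(n)$, $n\in\mathbb{Z}$). -/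

import Mathlib

open CategoryTheory CategoryTheory.Limits Opposite AlgebraicGeometry

universe u v

noncomputable section

/-! ### Categorical purity in a preadditive category -/

section CategoricalPurity

variable {C : Type u} [Category.{v} C] [Preadditive C]

/-- A sequence `0 ⟶ S.X₁ ⟶ S.X₂ ⟶ S.X₃ ⟶ 0` is c-pure-exact if it is short exact and stays so
after applying `Hom(F, -)` for every finitely presented object `F`, i.e. every object `F` such that
`Hom(F, -)` commutes with (small) direct limits. -/
def IsCPureExact (S : ShortComplex C) : Prop :=
  S.ShortExact ∧
    ∀ F : C, IsFinitelyPresentable.{v} F →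
      (S.map (preadditiveCoyoneda.obj (op F))).ShortExact

/-- `N` is c-pure-injective if `Hom(-, N)` sends c-pure-exact sequences to short exact sequences
of abelian groups. -/
def IsCPureInjective (N : C) : Prop :=
  ∀ S : ShortComplex C, IsCPureExact S →
    (S.op.map (preadditiveYoneda.obj N)).ShortExact

/-- `N` is Σ-c-pure-injective if for every set `I` the direct sum `N^(I)` exists and is
c-pure-injective. -/
def IsSigmaCPureInjective (N : C) : Prop :=
  ∀ I : Type v, ∃ _ : HasCoproduct (fun _ : I => N), IsCPureInjective (∐ fun _ : I => N)

end CategoricalPurity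

/-! ### Quasicoherent sheaves, line bundles and the projective line -/

/-- The category of quasicoherent sheaves on `X`, as a full subcategory of `𝒪_X`-modules. -/
abbrev QCoh (X : Scheme.{u}) : Type (u + 1) :=
  ObjectProperty.FullSubcategory (fun M : X.Modules =>
    SheafOfModules.IsQuasicoherent.{u} (R := X.ringCatSheaf) M)

/-- The structure sheaf, as a module over itself. -/
def structureModule (X : Scheme.{u}) : X.Modules :=
  SheafOfModules.unit X.ringCatSheaf

theorem isQuasicoherent_structureModule (X : Scheme.{u}) :
    SheafOfModules.IsQuasicoherent.{u} (R := X.ringCatSheaf) (structureModule X) := by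
  let e : SheafOfModules.free (R := X.ringCatSheaf) PUnit.{u + 1} ≅
      SheafOfModules.unit X.ringCatSheaf :=
    coproductUniqueIso (fun _ : PUnit.{u + 1} => SheafOfModules.unit X.ringCatSheaf)
  exact (SheafOfModules.isQuasicoherent X.ringCatSheaf).prop_of_iso e inferInstance

/-- The structure sheaf as an object of `QCoh X`. -/
def QCoh.structureSheaf (X : Scheme.{u}) : QCoh X :=
  ⟨structureModule X, isQuasicoherent_structureModule X⟩

/-- An `𝒪_X`-module is a line bundle if it is locally isomorphic to the structure sheaf. -/
def IsLineBundle {X : Scheme.{u}} (L : X.Modules) : Prop :=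
  ∀ x : X, ∃ U : X.Opens, x ∈ U ∧ Nonempty (L.restrict U.ι ≅ structureModule (U : Scheme.{u}))

/-- The projective line `ℙ¹_k = Proj k[x₀, x₁]`, with the standard grading. -/
def projectiveLine (k : Type u) [Field k] : Scheme.{u} :=
  letI : GradedAlgebra (MvPolynomial.homogeneousSubmodule (Fin 2) k) := MvPolynomial.gradedAlgebra
  Proj (MvPolynomial.homogeneousSubmodule (Fin 2) k)

end

/-!
# Line bundles on the projective line are Σ-c-pure-injective

The projective line is covered by two affine lines whose coordinates `T` and `T⁻¹` are inverse to
each other on the intersection. A quasi-coherent module `M` is thus given by its sections over the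
two charts, a module `M₀` over `k[T]` and a module `M₁` over `k[T⁻¹]`, with a common localization
`M₀₁`. A line bundle is free of rank one over each chart, and the units of `k[T, T⁻¹]` are the
monomials up to scalars, so a direct sum `N` of copies of a line bundle has compatible bases `e₀`,
`e₁` with transition function `T ^ n` (`TwoCharts.exists_monomialBases`,
`TwoCharts.nonempty_monomialBases_coproduct`).

*What purity gives.* For a unit `w` of `k[T, T⁻¹]`, the module with generators `e₀` and `e₁` over
the two charts and the relation `e₀ = w e₁` is quasi-coherent, and it is finitely presented, because
sections over the charts commute with direct limits (`TwoCharts.exists_qcoh_twist`,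
`TwoCharts.isFinitelyPresentable_of_existsUnique`). Morphisms from it to `M` are the pairs of
sections `x₀`, `x₁` with `x₀ = w x₁`. Every section over a chart occurs in such a pair, so a
c-pure-exact sequence `0 → A → B → C → 0` is exact on sections over the charts. As such pairs lift
from `C` to `B`, the quotient `A₀₁ / (A₀ + w A₁)`, which is the first Čech cohomology of a twist of
`A`, injects into the one of `B` (`TwoCharts.exists_eq_res_add_res`).

*Extension of morphisms.* This is an elementary form of Serre duality. Let `φ : A → N` be a
morphism. Its residue, the coefficient of `T⁻¹` of `φ` on `A₀₁`, is a `k`-linear map with values in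
a vector space which kills `A₀ + T ^ (n - 2) A₁`. Conversely, a `k`-linear map `l` on `B₀₁` which
kills `B₀ + T ^ (n - 2) B₁` is the residue of a morphism `B → N`: the coefficient of `T ^ j` in the
value at `y` has to be `l (T ^ (-1 - j) y)`, which is zero for almost all `j` because high powers
of `T` take `y` to `B₀` and high powers of `T⁻¹` take it to `T ^ (n - 2) B₁`. So extending `φ` to `B`
amounts to extending a linear map over a field along an injection of quotient spaces
(`TwoCharts.MonomialBases.exists_extension`). Only the freeness of `N` over the charts with a common
exponent `n` is used, hence infinite direct sums cause no trouble.

The last part identifies the standard open subsets of `Proj k[x₀, x₁]` with affine lines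
(`projectiveLineCharts`, `isStandard_projectiveLineCharts`).
-/

noncomputable section

/-! ### Sections of a module over an affine chart -/

section Charts

open Scheme.Modules

variable {X : Scheme.{u}} {R S : CommRingCat.{u}}

/-- For an affine chart `f : Spec R ⟶ X`, the functor sending an `𝒪_X`-module to the `R`-module of
its sections over the image of `f`. -/
def chartSections (f : Spec R ⟶ X) [IsOpenImmersion f] : X.Modules ⥤ ModuleCat.{u} R :=
  restrictFunctor f ⋙ moduleSpecΓFunctor (R := R)

/-- The identification of `R` with the ring of functions on the image of a chart `Spec R ⟶ X`. -/
def chartRingHom (f : Spec R ⟶ X) [IsOpenImmersion f] : R ⟶ Γ(X, f ''ᵁ ⊤) :=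
  (Scheme.ΓSpecIso R).inv ≫ (f.appIso ⊤).inv

lemma chartRingHom_res {f : Spec R ⟶ X} [IsOpenImmersion f] (φ : R ⟶ S) {f' : Spec S ⟶ X}
    [IsOpenImmersion f'] (h : Spec.map φ ≫ f = f') (H : f' ''ᵁ ⊤ ≤ f ''ᵁ ⊤) :
    chartRingHom f ≫ X.presheaf.map (homOfLE H).op = φ ≫ chartRingHom f' := by
  have h2 : chartRingHom f ≫ X.presheaf.map (homOfLE H).op ≫ (f'.appIso ⊤).hom =
      (φ ≫ chartRingHom f') ≫ (f'.appIso ⊤).hom := by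
    subst h
    simp [chartRingHom, Scheme.Hom.appIso_hom', Scheme.Hom.app_eq_appLE]
    erw [Scheme.Hom.map_appLE, Scheme.Hom.appLE_comp_appLE, ← Scheme.Hom.appIso_hom',
      Iso.inv_hom_id, Category.comp_id]
  rw [← cancel_mono (f'.appIso ⊤).hom, Category.assoc, h2]

lemma image_top_le_of_comp_eq {f : Spec R ⟶ X} [IsOpenImmersion f] {φ : R ⟶ S} {f' : Spec S ⟶ X}
    [IsOpenImmersion f'] (h : Spec.map φ ≫ f = f') : f' ''ᵁ ⊤ ≤ f ''ᵁ ⊤ := by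
  subst h
  rintro _ ⟨x, -, rfl⟩
  exact ⟨Spec.map φ x, trivial, by simp⟩

/-- Restriction of sections from a chart `f : Spec R ⟶ X` to a smaller chart `f' : Spec S ⟶ X`, as
a map semilinear over the ring homomorphism `R ⟶ S`. -/
def chartRes {f : Spec R ⟶ X} [IsOpenImmersion f] {φ : R ⟶ S} {f' : Spec S ⟶ X}
    [IsOpenImmersion f'] (h : Spec.map φ ≫ f = f') (M : X.Modules) :
    (chartSections f).obj M →ₛₗ[φ.hom] (chartSections f').obj M where
  toFun x := M.presheaf.map (homOfLE (image_top_le_of_comp_eq h)).op x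
  map_add' x y := map_add (M.presheaf.map (homOfLE (image_top_le_of_comp_eq h)).op).hom
    x y
  map_smul' r x :=
    (Scheme.Modules.map_smul M (homOfLE (image_top_le_of_comp_eq h)) (chartRingHom f r)
      x).trans (congrArg (fun s : Γ(X, f' ''ᵁ ⊤) =>
      s • M.presheaf.map (homOfLE (image_top_le_of_comp_eq h)).op x)
        congr($(chartRingHom_res φ h (image_top_le_of_comp_eq h)) r))

lemma chartRes_map {f : Spec R ⟶ X} [IsOpenImmersion f] {φ : R ⟶ S} {f' : Spec S ⟶ X}
    [IsOpenImmersion f'] (h : Spec.map φ ≫ f = f') {M N : X.Modules} (g : M ⟶ N)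
    (x : (chartSections f).obj M) :
    chartRes h N ((chartSections f).map g x) = (chartSections f').map g (chartRes h M x) :=
  (congr($(g.mapPresheaf.naturality (homOfLE (image_top_le_of_comp_eq h)).op) x)).symm

lemma presheaf_map_map (M : X.Modules) {U V W : X.Opens} (h₁ : V ≤ U) (h₂ : W ≤ V) (x : Γ(M, U)) :
    M.presheaf.map (homOfLE h₂).op (M.presheaf.map (homOfLE h₁).op x) =
      M.presheaf.map (homOfLE (h₂.trans h₁)).op x := by
  rw [← ConcreteCategory.comp_apply, ← Functor.map_comp]
  rfl

lemma presheaf_map_self (M : X.Modules) {U : X.Opens} (h : U ≤ U) (x : Γ(M, U)) :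
    M.presheaf.map (homOfLE h).op x = x :=
  congr($(M.presheaf.map_id (op U)) x)

lemma image_le_image_top (f : Spec R ⟶ X) [IsOpenImmersion f] (U : (Spec R).Opens) :
    f ''ᵁ U ≤ f ''ᵁ ⊤ := f.image_mono le_top

/-- The scalar action of `R` on the sections of the restriction of `M` to a chart is the action of
functions on `X`. -/
lemma restrict_smul_eq (f : Spec R ⟶ X) [IsOpenImmersion f] (M : X.Modules) (U : (Spec R).Opens)
    (r : R) (x : Γ(M, f ''ᵁ U)) :
    @HSMul.hSMul R Γ(M.restrict f, U) Γ(M.restrict f, U) _ r x =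
      @HSMul.hSMul Γ(X, f ''ᵁ U) Γ(M, f ''ᵁ U) Γ(M, f ''ᵁ U) _
        (X.presheaf.map (homOfLE (image_le_image_top f U)).op (chartRingHom f r)) x := by
  have h : (Spec R).presheaf.map U.leTop.op ≫ (f.appIso U).inv =
      (f.appIso ⊤).inv ≫ X.presheaf.map (homOfLE (image_le_image_top f U)).op :=
    f.appIso_inv_naturality U.leTop.op
  exact congrArg (fun s : Γ(X, f ''ᵁ U) => s • x) congr($h ((Scheme.ΓSpecIso R).inv r))

section Localization

/-- Sections of a quasi-coherent module over a principal open subset of a chart are the localization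
of the sections over the chart. -/
lemma isLocalizedModule_restrict (f : Spec R ⟶ X) [IsOpenImmersion f] (M : X.Modules)
    [SheafOfModules.IsQuasicoherent.{u} (R := X.ringCatSheaf) M] (r : R) :
    IsLocalizedModule (.powers r) ((modulesSpecToSheaf.obj (M.restrict f)).obj.map
      (PrimeSpectrum.basicOpen r).leTop.op).hom := by
  have : IsIso (M.restrict f).fromTildeΓ := inferInstance
  exact (isIso_fromTildeΓ_iff_isLocalizing _).mp this r

variable {f : Spec R ⟶ X} [IsOpenImmersion f] {φ : R ⟶ S} {f' : Spec S ⟶ X}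
    [IsOpenImmersion f'] (h : Spec.map φ ≫ f = f') {U : (Spec R).Opens}
    (hr : f' ''ᵁ ⊤ = f ''ᵁ U) (M : X.Modules)

include h hr

/-- Sections over an open subset `U` of the first chart, when `U` is the image of the second chart:
the identification with sections over the second chart is semilinear. -/
lemma map_restrict_smul (s : R) (y : Γ(M, f ''ᵁ U)) :
    M.presheaf.map (homOfLE hr.le).op (@HSMul.hSMul R Γ(M.restrict f, U) Γ(M.restrict f, U) _ s y) =
    @HSMul.hSMul S ((chartSections f').obj M) ((chartSections f').obj M) _ (φ.hom s)
      (M.presheaf.map (homOfLE hr.le).op y) := by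
  rw [restrict_smul_eq]
  refine (Scheme.Modules.map_smul M _ _ _).trans ?_
  have := congr($(chartRingHom_res φ h (image_top_le_of_comp_eq h)) s)
  rw [← ConcreteCategory.comp_apply, ← Functor.map_comp]
  exact congrArg (fun s : Γ(X, f' ''ᵁ ⊤) => s • M.presheaf.map (homOfLE hr.le).op y) this

variable {r : R} (hU : U = PrimeSpectrum.basicOpen r)
  [hM : SheafOfModules.IsQuasicoherent.{u} (R := X.ringCatSheaf) M]

include hU

/-- A section over the principal open subset `r ≠ 0` of a chart extends to the whole chart after
multiplication by a power of `r`. -/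
lemma exists_chartRes_eq_pow_smul (y : (chartSections f').obj M) :
    ∃ (n : ℕ) (x : (chartSections f).obj M), chartRes h M x = φ.hom r ^ n • y := by
  have := isLocalizedModule_restrict f M r
  obtain ⟨⟨x, ⟨_, n, rfl⟩⟩, hx⟩ := IsLocalizedModule.surj (.powers r)
    ((modulesSpecToSheaf.obj (M.restrict f)).obj.map (PrimeSpectrum.basicOpen r).leTop.op).hom
    (M.presheaf.map (homOfLE (hU ▸ hr.ge)).op y)
  subst hU
  refine ⟨n, x, ?_⟩
  have h2 := map_restrict_smul h hr M (r ^ n) (M.presheaf.map (homOfLE hr.ge).op y)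
  rw [← map_pow]
  refine Eq.trans ?_ ((congrArg (M.presheaf.map (homOfLE hr.le).op) hx.symm).trans
    (h2.trans (congrArg (φ.hom (r ^ n) • ·)
      ((presheaf_map_map M hr.ge hr.le y).trans (presheaf_map_self M _ y)))))
  exact (presheaf_map_map M (image_le_image_top f _) hr.le x).symm

/-- A section over a chart that vanishes on the principal open subset `r ≠ 0` is killed by a power
of `r`. -/
lemma exists_pow_smul_eq_zero (x : (chartSections f).obj M) (hx : chartRes h M x = 0) :
    ∃ n : ℕ, r ^ n • x = 0 := by
  subst hU
  have := isLocalizedModule_restrict f M r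
  have hx' : ((modulesSpecToSheaf.obj (M.restrict f)).obj.map
      (PrimeSpectrum.basicOpen r).leTop.op).hom x = 0 :=
    (presheaf_map_map M (image_top_le_of_comp_eq h) hr.ge x).symm.trans
      ((congrArg (M.presheaf.map (homOfLE hr.ge).op) hx).trans
        (map_zero (M.presheaf.map (homOfLE hr.ge).op).hom))
  obtain ⟨⟨_, n, rfl⟩, hn⟩ := (IsLocalizedModule.eq_zero_iff (.powers r) _).mp hx'
  exact ⟨n, hn⟩

end Localization

end Charts

/-! ### Gluing morphisms of modules over two charts -/

section HomGluing

open Scheme.Modules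

variable {X : Scheme.{u}}

/-- A morphism of `𝒪_X`-modules from an additive, `𝒪_X`-linear family of maps on sections that is
compatible with restriction. -/
def modulesHomMk {M N : X.Modules} (φ : ∀ U : X.Opens, Γ(M, U) →+ Γ(N, U))
    (hnat : ∀ (U V : X.Opens) (h : V ≤ U) (x : Γ(M, U)),
      φ V (M.presheaf.map (homOfLE h).op x) = N.presheaf.map (homOfLE h).op (φ U x))
    (hsmul : ∀ (U : X.Opens) (r : Γ(X, U)) (x : Γ(M, U)), φ U (r • x) = r • φ U x) : M ⟶ N :=
  ⟨PresheafOfModules.homMk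
    { app U := AddCommGrpCat.ofHom (φ U.unop)
      naturality U V i := by
        ext x
        exact hnat U.unop V.unop (leOfHom i.unop) x } (fun U r x => hsmul U.unop r x)⟩

lemma app_presheaf_map {M N : X.Modules} (g : M ⟶ N) {U V : X.Opens} (h : V ≤ U) (x : Γ(M, U)) :
    g.app V (M.presheaf.map (homOfLE h).op x) = N.presheaf.map (homOfLE h).op (g.app U x) :=
  congr($(g.mapPresheaf.naturality (homOfLE h).op) x)

/-- The sheaf condition for an open set covered by two open sets. -/
lemma existsUnique_glue_two (N : X.Modules) {W A B C : X.Opens} (hA : A ≤ W) (hB : B ≤ W)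
    (hCA : C ≤ A) (hCB : C ≤ B) (hC : A ⊓ B ≤ C) (hW : W ≤ A ⊔ B) (x : Γ(N, A)) (y : Γ(N, B))
    (hxy : N.presheaf.map (homOfLE hCA).op x = N.presheaf.map (homOfLE hCB).op y) :
    ∃! z : Γ(N, W), N.presheaf.map (homOfLE hA).op z = x ∧
      N.presheaf.map (homOfLE hB).op z = y := by
  have hle : ∀ i : Bool, (bif i then A else B) ≤ W := by rintro (_ | _) <;> assumption
  have hxy' : N.presheaf.map (homOfLE (inf_le_left : A ⊓ B ≤ A)).op x =
      N.presheaf.map (homOfLE (inf_le_right : A ⊓ B ≤ B)).op y := by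
    rw [← presheaf_map_map N hCA hC, hxy, presheaf_map_map]
  have hxy'' : N.presheaf.map (homOfLE (inf_le_right : B ⊓ A ≤ A)).op x =
      N.presheaf.map (homOfLE (inf_le_left : B ⊓ A ≤ B)).op y := by
    rw [← presheaf_map_map N hCA ((inf_comm B A).le.trans hC), hxy, presheaf_map_map]
  obtain ⟨z, hz, huniq⟩ := TopCat.Sheaf.existsUnique_gluing' ⟨_, N.isSheaf⟩
    (fun i : Bool => bif i then A else B) W (fun i => homOfLE (hle i))
    (by rw [iSup_bool_eq]; exact hW)
    (fun i => match i with | true => x | false => y) (by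
      rintro (_ | _) (_ | _)
      · rfl
      · exact hxy''.symm
      · exact hxy'
      · rfl)
  refine ⟨z, ⟨hz true, hz false⟩, fun w hw => huniq w ?_⟩
  rintro (_ | _)
  · exact hw.2
  · exact hw.1

variable {R R₀ R₁ S : CommRingCat.{u}}

/-- On an affine scheme, a morphism out of a quasi-coherent module is the same thing as a linear map
on global sections, as `M` is then the sheaf associated with its global sections. -/
lemma moduleSpecΓFunctor_map_bijective (M N : (Spec R).Modules)
    [SheafOfModules.IsQuasicoherent.{u} (R := (Spec R).ringCatSheaf) M] :
    Function.Bijective (fun f : M ⟶ N => (moduleSpecΓFunctor (R := R)).map f) := by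
  have : IsIso M.fromTildeΓ := inferInstance
  have : IsIso ((tilde.adjunction (R := R)).counit.app M) := this
  have h : (fun f : M ⟶ N => (moduleSpecΓFunctor (R := R)).map f) =
      (tilde.adjunction (R := R)).homEquiv _ _ ∘
        fun f => (tilde.adjunction (R := R)).counit.app M ≫ f := by
    funext f
    simp [Adjunction.homEquiv_unit]
  rw [h]
  refine (Equiv.bijective _).comp ⟨fun f g hfg => (cancel_epi _).mp hfg, fun f =>
    ⟨inv ((tilde.adjunction (R := R)).counit.app M) ≫ f, by simp⟩⟩

lemma restrict_app_smul {Y : Scheme.{u}} (f : Y ⟶ X) [IsOpenImmersion f] {M N : X.Modules}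
    (γ : M.restrict f ⟶ N.restrict f) (U : Y.Opens) (r : Γ(X, f ''ᵁ U)) (x : Γ(M, f ''ᵁ U)) :
    γ.app U (@HSMul.hSMul Γ(X, f ''ᵁ U) Γ(M, f ''ᵁ U) Γ(M, f ''ᵁ U) _ r x) =
      @HSMul.hSMul Γ(X, f ''ᵁ U) Γ(N, f ''ᵁ U) Γ(N, f ''ᵁ U) _ r (γ.app U x) := by
  have hr : (f.appIso U).inv ((f.appIso U).hom r) = r := by simp
  have h := γ.app_smul ((f.appIso U).hom r) x
  rw [← hr]
  exact h

/-- Restriction of a morphism from a chart to a smaller chart. -/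
lemma exists_restrict_hom {f : Spec R ⟶ X} [IsOpenImmersion f] {φ : R ⟶ S} {f' : Spec S ⟶ X}
    [IsOpenImmersion f'] (h : Spec.map φ ≫ f = f') {M N : X.Modules}
    (γ : M.restrict f ⟶ N.restrict f) :
    ∃ δ : M.restrict f' ⟶ N.restrict f', ∀ (U : (Spec R).Opens) (V : (Spec S).Opens)
      (hVU : f' ''ᵁ V ≤ f ''ᵁ U) (x : Γ(M, f ''ᵁ U)),
      δ.app V (M.presheaf.map (homOfLE hVU).op x) =
        N.presheaf.map (homOfLE hVU).op (γ.app U x) := by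
  subst h
  have : IsOpenImmersion (Spec.map φ) := IsOpenImmersion.of_comp _ f
  refine ⟨(restrictFunctorComp (Spec.map φ) f).hom.app M ≫
    (restrictFunctor (Spec.map φ)).map γ ≫ (restrictFunctorComp (Spec.map φ) f).inv.app N,
    fun U V hVU x => ?_⟩
  have hV : f ''ᵁ (Spec.map φ ''ᵁ V) = (Spec.map φ ≫ f) ''ᵁ V := by simp
  have hVU' : Spec.map φ ''ᵁ V ≤ U := (f.image_le_image_iff _ _).mp (hV.le.trans hVU)
  have h1 : γ.app (Spec.map φ ''ᵁ V) (M.presheaf.map (homOfLE (hV.le.trans hVU)).op x) =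
      N.presheaf.map (homOfLE (hV.le.trans hVU)).op (γ.app U x) :=
    app_presheaf_map γ hVU' x
  refine Eq.trans ?_ (presheaf_map_map N (hV.le.trans hVU) hV.ge (γ.app U x))
  refine Eq.trans ?_ (congrArg (N.presheaf.map (homOfLE hV.ge).op) h1)
  exact congrArg (fun z => N.presheaf.map (homOfLE hV.ge).op (γ.app (Spec.map φ ''ᵁ V) z))
    (presheaf_map_map M hVU hV.le x)

end HomGluing

/-- A scheme covered by two affine charts whose intersection is affine and is a principal open
subset of each of them. -/
structure TwoCharts (X : Scheme.{u}) (R₀ R₁ S : CommRingCat.{u}) where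
  /-- The first chart. -/
  j₀ : Spec R₀ ⟶ X
  /-- The second chart. -/
  j₁ : Spec R₁ ⟶ X
  /-- The intersection of the two charts. -/
  j₀₁ : Spec S ⟶ X
  /-- Restriction of functions from the first chart to the intersection. -/
  a : R₀ ⟶ S
  /-- Restriction of functions from the second chart to the intersection. -/
  b : R₁ ⟶ S
  open₀ : IsOpenImmersion j₀
  open₁ : IsOpenImmersion j₁
  open₀₁ : IsOpenImmersion j₀₁
  comp₀ : Spec.map a ≫ j₀ = j₀₁
  comp₁ : Spec.map b ≫ j₁ = j₀₁
  sup_eq : j₀ ''ᵁ ⊤ ⊔ j₁ ''ᵁ ⊤ = ⊤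
  inf_le : j₀ ''ᵁ ⊤ ⊓ j₁ ''ᵁ ⊤ ≤ j₀₁ ''ᵁ ⊤
  /-- A function on the first chart whose non-vanishing locus is the intersection. -/
  t : R₀
  /-- A function on the second chart whose non-vanishing locus is the intersection. -/
  s : R₁
  image₀ : j₀₁ ''ᵁ ⊤ = j₀ ''ᵁ (PrimeSpectrum.basicOpen t)
  image₁ : j₀₁ ''ᵁ ⊤ = j₁ ''ᵁ (PrimeSpectrum.basicOpen s)
  isUnit_a : IsUnit (a.hom t)
  isUnit_b : IsUnit (b.hom s)

namespace TwoCharts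

attribute [instance] open₀ open₁ open₀₁

open Scheme.Modules

variable {X : Scheme.{u}} {R₀ R₁ S : CommRingCat.{u}} (c : TwoCharts X R₀ R₁ S)

/-- Sections over the first chart. -/
abbrev sec₀ : X.Modules ⥤ ModuleCat.{u} R₀ := chartSections c.j₀

/-- Sections over the second chart. -/
abbrev sec₁ : X.Modules ⥤ ModuleCat.{u} R₁ := chartSections c.j₁

/-- Sections over the intersection of the charts. -/
abbrev sec₀₁ : X.Modules ⥤ ModuleCat.{u} S := chartSections c.j₀₁

/-- Restriction of sections from the first chart to the intersection. -/
abbrev res₀ (M : X.Modules) : c.sec₀.obj M →ₛₗ[c.a.hom] c.sec₀₁.obj M := chartRes c.comp₀ M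

/-- Restriction of sections from the second chart to the intersection. -/
abbrev res₁ (M : X.Modules) : c.sec₁.obj M →ₛₗ[c.b.hom] c.sec₀₁.obj M := chartRes c.comp₁ M

lemma image_preimage_inf_le (W : X.Opens) :
    c.j₀ ''ᵁ c.j₀ ⁻¹ᵁ W ⊓ c.j₁ ''ᵁ c.j₁ ⁻¹ᵁ W ≤ c.j₀₁ ''ᵁ c.j₀₁ ⁻¹ᵁ W := by
  rintro _ ⟨⟨x, hx, rfl⟩, ⟨y, hy, hxy⟩⟩
  obtain ⟨z, -, hz⟩ := c.inf_le ⟨⟨x, trivial, rfl⟩, ⟨y, trivial, hxy⟩⟩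
  refine ⟨z, ?_, hz⟩
  change c.j₀₁ z ∈ W
  exact hz ▸ hx

lemma le_image_preimage_sup (W : X.Opens) :
    W ≤ c.j₀ ''ᵁ c.j₀ ⁻¹ᵁ W ⊔ c.j₁ ''ᵁ c.j₁ ⁻¹ᵁ W := by
  intro x hx
  rcases c.sup_eq.ge (Set.mem_univ x) with ⟨y, -, rfl⟩ | ⟨y, -, rfl⟩
  · exact Or.inl ⟨y, hx, rfl⟩
  · exact Or.inr ⟨y, hx, rfl⟩

lemma image_preimage_le₀ (W : X.Opens) : c.j₀₁ ''ᵁ c.j₀₁ ⁻¹ᵁ W ≤ c.j₀ ''ᵁ c.j₀ ⁻¹ᵁ W := by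
  rintro _ ⟨x, hx, rfl⟩
  exact ⟨Spec.map c.a x, by
    change c.j₀ (Spec.map c.a x) ∈ W
    rw [← Scheme.Hom.comp_apply, c.comp₀]; exact hx, by
    rw [← c.comp₀]; rfl⟩

lemma image_preimage_le₁ (W : X.Opens) : c.j₀₁ ''ᵁ c.j₀₁ ⁻¹ᵁ W ≤ c.j₁ ''ᵁ c.j₁ ⁻¹ᵁ W := by
  rintro _ ⟨x, hx, rfl⟩
  exact ⟨Spec.map c.b x, by
    change c.j₁ (Spec.map c.b x) ∈ W
    rw [← Scheme.Hom.comp_apply, c.comp₁]; exact hx, by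
    rw [← c.comp₁]; rfl⟩

/-- Compatible morphisms over the two charts glue. -/
lemma exists_glue_hom {M N : X.Modules} (γ₀ : M.restrict c.j₀ ⟶ N.restrict c.j₀)
    (γ₁ : M.restrict c.j₁ ⟶ N.restrict c.j₁)
    (δ : M.restrict c.j₀₁ ⟶ N.restrict c.j₀₁)
    (h₀ : ∀ (U : (Spec R₀).Opens) (V : (Spec S).Opens) (hVU : c.j₀₁ ''ᵁ V ≤ c.j₀ ''ᵁ U)
      (x : Γ(M, c.j₀ ''ᵁ U)), δ.app V (M.presheaf.map (homOfLE hVU).op x) =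
        N.presheaf.map (homOfLE hVU).op (γ₀.app U x))
    (h₁ : ∀ (U : (Spec R₁).Opens) (V : (Spec S).Opens) (hVU : c.j₀₁ ''ᵁ V ≤ c.j₁ ''ᵁ U)
      (x : Γ(M, c.j₁ ''ᵁ U)), δ.app V (M.presheaf.map (homOfLE hVU).op x) =
        N.presheaf.map (homOfLE hVU).op (γ₁.app U x)) :
    ∃ g : M ⟶ N, (∀ (W : X.Opens) (x : Γ(M, W)),
      N.presheaf.map (homOfLE (c.j₀.image_preimage_le W)).op (g.app W x) =
        γ₀.app (c.j₀ ⁻¹ᵁ W) (M.presheaf.map (homOfLE (c.j₀.image_preimage_le W)).op x)) ∧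
      (∀ (W : X.Opens) (x : Γ(M, W)),
      N.presheaf.map (homOfLE (c.j₁.image_preimage_le W)).op (g.app W x) =
        γ₁.app (c.j₁ ⁻¹ᵁ W) (M.presheaf.map (homOfLE (c.j₁.image_preimage_le W)).op x)) := by
  have key (W : X.Opens) (x : Γ(M, W)) := existsUnique_glue_two N (c.j₀.image_preimage_le W)
    (c.j₁.image_preimage_le W) (c.image_preimage_le₀ W) (c.image_preimage_le₁ W)
    (c.image_preimage_inf_le W) (c.le_image_preimage_sup W)
    (γ₀.app (c.j₀ ⁻¹ᵁ W) (M.presheaf.map (homOfLE (c.j₀.image_preimage_le W)).op x))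
    (γ₁.app (c.j₁ ⁻¹ᵁ W) (M.presheaf.map (homOfLE (c.j₁.image_preimage_le W)).op x))
    ((h₀ _ _ (c.image_preimage_le₀ W) _).symm.trans (Eq.trans (congrArg (δ.app (c.j₀₁ ⁻¹ᵁ W))
      ((presheaf_map_map M _ _ x).trans (presheaf_map_map M _ _ x).symm))
      (h₁ _ _ (c.image_preimage_le₁ W) _)))
  choose φ hφ huniq using key
  refine ⟨modulesHomMk (fun W => AddMonoidHom.mk' (φ W) fun x y => ?_) ?_ ?_,
    fun W x => (hφ W x).1, fun W x => (hφ W x).2⟩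
  · refine (huniq W (x + y) _ ⟨?_, ?_⟩).symm
    · simp only [map_add]
      rw [(hφ W x).1, (hφ W y).1]
      exact (map_add (γ₀.app (c.j₀ ⁻¹ᵁ W)).hom _ _).symm
    · simp only [map_add]
      rw [(hφ W x).2, (hφ W y).2]
      exact (map_add (γ₁.app (c.j₁ ⁻¹ᵁ W)).hom _ _).symm
  · intro U V h x
    refine (huniq V _ _ ⟨?_, ?_⟩).symm
    · have h' : c.j₀ ⁻¹ᵁ V ≤ c.j₀ ⁻¹ᵁ U := c.j₀.preimage_mono h
      refine (presheaf_map_map N h (c.j₀.image_preimage_le V) _).trans ?_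
      refine (presheaf_map_map N (c.j₀.image_preimage_le U) (c.j₀.image_mono h') _).symm.trans ?_
      refine (congrArg _ (hφ U x).1).trans ?_
      refine (app_presheaf_map γ₀ h' _).symm.trans (congrArg (γ₀.app (c.j₀ ⁻¹ᵁ V)) ?_)
      exact (presheaf_map_map M (c.j₀.image_preimage_le U) (c.j₀.image_mono h') x).trans
        (presheaf_map_map M h (c.j₀.image_preimage_le V) x).symm
    · have h' : c.j₁ ⁻¹ᵁ V ≤ c.j₁ ⁻¹ᵁ U := c.j₁.preimage_mono h
      refine (presheaf_map_map N h (c.j₁.image_preimage_le V) _).trans ?_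
      refine (presheaf_map_map N (c.j₁.image_preimage_le U) (c.j₁.image_mono h') _).symm.trans ?_
      refine (congrArg _ (hφ U x).2).trans ?_
      refine (app_presheaf_map γ₁ h' _).symm.trans (congrArg (γ₁.app (c.j₁ ⁻¹ᵁ V)) ?_)
      exact (presheaf_map_map M (c.j₁.image_preimage_le U) (c.j₁.image_mono h') x).trans
        (presheaf_map_map M h (c.j₁.image_preimage_le V) x).symm
  · intro U r x
    refine (huniq U _ _ ⟨?_, ?_⟩).symm
    · refine (Scheme.Modules.map_smul N _ r (φ U x)).trans ?_
      refine (congrArg _ (hφ U x).1).trans ?_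
      refine (restrict_app_smul c.j₀ γ₀ (c.j₀ ⁻¹ᵁ U) _ _).symm.trans ?_
      exact congrArg (γ₀.app (c.j₀ ⁻¹ᵁ U)) (Scheme.Modules.map_smul M _ r x).symm
    · refine (Scheme.Modules.map_smul N _ r (φ U x)).trans ?_
      refine (congrArg _ (hφ U x).2).trans ?_
      refine (restrict_app_smul c.j₁ γ₁ (c.j₁ ⁻¹ᵁ U) _ _).symm.trans ?_
      exact congrArg (γ₁.app (c.j₁ ⁻¹ᵁ U)) (Scheme.Modules.map_smul M _ r x).symm

section Quasicoherent

variable {M N : X.Modules} [hM : SheafOfModules.IsQuasicoherent.{u} (R := X.ringCatSheaf) M]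

/-- Morphisms out of a quasi-coherent module agree if they agree on sections over both charts. -/
lemma hom_ext {g g' : M ⟶ N} (h₀ : ∀ x, c.sec₀.map g x = c.sec₀.map g' x)
    (h₁ : ∀ x, c.sec₁.map g x = c.sec₁.map g' x) : g = g' := by
  have e₀ : (restrictFunctor c.j₀).map g = (restrictFunctor c.j₀).map g' :=
    (moduleSpecΓFunctor_map_bijective (M.restrict c.j₀) (N.restrict c.j₀)).1 (by
      ext x
      exact h₀ x)
  have e₁ : (restrictFunctor c.j₁).map g = (restrictFunctor c.j₁).map g' :=
    (moduleSpecΓFunctor_map_bijective (M.restrict c.j₁) (N.restrict c.j₁)).1 (by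
      ext x
      exact h₁ x)
  refine Scheme.Modules.hom_ext _ _ fun W => ?_
  ext x
  have k₀ : N.presheaf.map (homOfLE (c.j₀.image_preimage_le W)).op (g.app W x) =
      N.presheaf.map (homOfLE (c.j₀.image_preimage_le W)).op (g'.app W x) := by
    rw [← app_presheaf_map, ← app_presheaf_map]
    exact congr(($e₀).app (c.j₀ ⁻¹ᵁ W)
      (M.presheaf.map (homOfLE (c.j₀.image_preimage_le W)).op x))
  have k₁ : N.presheaf.map (homOfLE (c.j₁.image_preimage_le W)).op (g.app W x) =
      N.presheaf.map (homOfLE (c.j₁.image_preimage_le W)).op (g'.app W x) := by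
    rw [← app_presheaf_map, ← app_presheaf_map]
    exact congr(($e₁).app (c.j₁ ⁻¹ᵁ W)
      (M.presheaf.map (homOfLE (c.j₁.image_preimage_le W)).op x))
  refine (existsUnique_glue_two N (c.j₀.image_preimage_le W)
    (c.j₁.image_preimage_le W) (c.image_preimage_le₀ W) (c.image_preimage_le₁ W)
    (c.image_preimage_inf_le W) (c.le_image_preimage_sup W) _ _ ?_).unique ⟨k₀, k₁⟩ ⟨rfl, rfl⟩
  rw [presheaf_map_map, presheaf_map_map]

/-- A linear map on the sections over the intersection is determined by its values on the sections
that extend to the first chart. -/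
lemma linearMap_ext₀₁ {P : ModuleCat.{u} S} {g g' : c.sec₀₁.obj M →ₗ[S] P}
    (h : ∀ x, g (c.res₀ M x) = g' (c.res₀ M x)) : g = g' := by
  ext y
  obtain ⟨n, x, hx⟩ := exists_chartRes_eq_pow_smul c.comp₀ c.image₀ M rfl y
  have h1 := h x
  rw [hx, _root_.map_smul, _root_.map_smul] at h1
  exact (c.isUnit_a.pow n).smul_left_cancel.mp h1

/-- A morphism out of a quasi-coherent module can be prescribed on sections over the two charts,
provided the prescriptions agree on the intersection. -/
theorem exists_hom (g₀ : c.sec₀.obj M →ₗ[R₀] c.sec₀.obj N)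
    (g₁ : c.sec₁.obj M →ₗ[R₁] c.sec₁.obj N) (g₀₁ : c.sec₀₁.obj M →ₗ[S] c.sec₀₁.obj N)
    (h₀ : ∀ x, c.res₀ N (g₀ x) = g₀₁ (c.res₀ M x))
    (h₁ : ∀ x, c.res₁ N (g₁ x) = g₀₁ (c.res₁ M x)) :
    ∃ g : M ⟶ N, (∀ x, c.sec₀.map g x = g₀ x) ∧ (∀ x, c.sec₁.map g x = g₁ x) := by
  let G₀ : c.sec₀.obj M ⟶ c.sec₀.obj N := (ModuleCat.ofHom g₀ :)
  let G₁ : c.sec₁.obj M ⟶ c.sec₁.obj N := (ModuleCat.ofHom g₁ :)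
  let G₀₁ : c.sec₀₁.obj M ⟶ c.sec₀₁.obj N := (ModuleCat.ofHom g₀₁ :)
  obtain ⟨γ₀, hγ₀⟩ := (moduleSpecΓFunctor_map_bijective (M.restrict c.j₀) (N.restrict c.j₀)).2 G₀
  obtain ⟨γ₁, hγ₁⟩ := (moduleSpecΓFunctor_map_bijective (M.restrict c.j₁) (N.restrict c.j₁)).2 G₁
  have hγ₀' (x : c.sec₀.obj M) : γ₀.app ⊤ x = g₀ x := congr(($hγ₀).hom x)
  have hγ₁' (x : c.sec₁.obj M) : γ₁.app ⊤ x = g₁ x := congr(($hγ₁).hom x)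
  obtain ⟨δ₀, hδ₀⟩ := exists_restrict_hom c.comp₀ γ₀
  obtain ⟨δ₁, hδ₁⟩ := exists_restrict_hom c.comp₁ γ₁
  have k₀ : (moduleSpecΓFunctor (R := S)).map δ₀ = G₀₁ := by
    ext1
    refine c.linearMap_ext₀₁ (P := c.sec₀₁.obj N) fun x => ?_
    refine (hδ₀ ⊤ ⊤ (image_top_le_of_comp_eq c.comp₀) x).trans ?_
    exact (congrArg (c.res₀ N) (hγ₀' x)).trans (h₀ x)
  have k₁ : (moduleSpecΓFunctor (R := S)).map δ₁ = G₀₁ := by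
    let D : c.sec₀₁.obj M →ₗ[S] c.sec₀₁.obj N := ((moduleSpecΓFunctor (R := S)).map δ₁).hom
    suffices hD : D = g₀₁ by
      ext1
      exact hD
    ext y
    obtain ⟨n, x, hx⟩ := exists_chartRes_eq_pow_smul c.comp₁ c.image₁ M rfl y
    have h1 : D (c.res₁ M x) = g₀₁ (c.res₁ M x) :=
      (hδ₁ ⊤ ⊤ (image_top_le_of_comp_eq c.comp₁) x).trans
        ((congrArg (c.res₁ N) (hγ₁' x)).trans (h₁ x))
    rw [hx, _root_.map_smul, _root_.map_smul] at h1
    exact (c.isUnit_b.pow n).smul_left_cancel.mp h1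
  have hδ : δ₀ = δ₁ := (moduleSpecΓFunctor_map_bijective (M.restrict c.j₀₁)
    (N.restrict c.j₀₁)).1 (k₀.trans k₁.symm)
  obtain ⟨g, hg₀, hg₁⟩ := c.exists_glue_hom γ₀ γ₁ δ₀ hδ₀ (hδ ▸ hδ₁)
  refine ⟨g, fun x => ?_, fun x => ?_⟩
  · have hW : c.j₀ ''ᵁ c.j₀ ⁻¹ᵁ (c.j₀ ''ᵁ ⊤) = c.j₀ ''ᵁ ⊤ := by
      rw [Scheme.Hom.preimage_image_eq]
    have h1 := (hg₀ (c.j₀ ''ᵁ ⊤) x).trans (app_presheaf_map γ₀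
      (le_top : c.j₀ ⁻¹ᵁ (c.j₀ ''ᵁ ⊤) ≤ ⊤) x)
    have h2 := congrArg (N.presheaf.map (homOfLE hW.ge).op) h1
    refine Eq.trans ?_ ((h2.trans ?_).trans (hγ₀' x))
    · exact ((presheaf_map_map N _ hW.ge _).trans (presheaf_map_self N _ _)).symm
    · exact (presheaf_map_map N _ hW.ge _).trans (presheaf_map_self N _ _)
  · have hW : c.j₁ ''ᵁ c.j₁ ⁻¹ᵁ (c.j₁ ''ᵁ ⊤) = c.j₁ ''ᵁ ⊤ := by
      rw [Scheme.Hom.preimage_image_eq]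
    have h1 := (hg₁ (c.j₁ ''ᵁ ⊤) x).trans (app_presheaf_map γ₁
      (le_top : c.j₁ ⁻¹ᵁ (c.j₁ ''ᵁ ⊤) ≤ ⊤) x)
    have h2 := congrArg (N.presheaf.map (homOfLE hW.ge).op) h1
    refine Eq.trans ?_ ((h2.trans ?_).trans (hγ₁' x))
    · exact ((presheaf_map_map N _ hW.ge _).trans (presheaf_map_self N _ _)).symm
    · exact (presheaf_map_map N _ hW.ge _).trans (presheaf_map_self N _ _)

end Quasicoherent

end TwoCharts

/-! ### Quasi-coherence is local, and is stable under colimits -/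

section Local

open Scheme.Modules

variable {X : Scheme.{u}} {R : CommRingCat.{u}}

/-- Transport of a presentation along an isomorphism of modules. -/
def presentationOfIso {M N : X.Modules} (e : M ≅ N)
    (p : SheafOfModules.Presentation.{u} (R := X.ringCatSheaf) M) :
    SheafOfModules.Presentation.{u} (R := X.ringCatSheaf) N :=
  @SheafOfModules.Presentation.ofIsIso _ _ _ _ _ _ _ _ e.hom (inferInstanceAs (IsIso e.hom)) p

/-- A global presentation of a quasi-coherent module on an affine scheme. -/
def presentationOfQuasicoherent (M : (Spec R).Modules)
    [SheafOfModules.IsQuasicoherent.{u} (R := (Spec R).ringCatSheaf) M] :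
    SheafOfModules.Presentation.{u} (R := (Spec R).ringCatSheaf) M :=
  presentationOfIso (@asIso (Spec R).Modules _ _ _ M.fromTildeΓ
    (isIso_fromTildeΓ_of_isQuasicoherent M))
    (presentationTilde.{u} _ .univ (by simp) _ (Submodule.span_eq _))

/-- If the restriction of `M` to an affine chart is quasi-coherent, then the restriction of `M` to
the slice site of the image of the chart has a global presentation. -/
def presentationOver (f : Spec R ⟶ X) [IsOpenImmersion f] (M : X.Modules)
    [SheafOfModules.IsQuasicoherent.{u} (R := (Spec R).ringCatSheaf) (M.restrict f)] :
    SheafOfModules.Presentation.{u} (SheafOfModules.over M f.opensRange) := by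
  let i : (f.opensRange : Scheme.{u}) ⟶ Spec R := f.isoOpensRange.inv
  let p := presentationRestrict i (presentationOfQuasicoherent (M.restrict f))
  let e : (M.restrict f).restrict i ≅ M.restrict f.opensRange.ι :=
    (restrictFunctorComp i f).symm.app M ≪≫ (restrictFunctorCongr (by simp [i])).app M
  let e' : (overEquiv f.opensRange).inverse.obj (M.restrict f.opensRange.ι) ≅
      SheafOfModules.over M f.opensRange :=
    (overEquiv f.opensRange).inverse.mapIso ((overFunctorEquiv f.opensRange).symm.app M) ≪≫
      (overEquiv f.opensRange).unitIso.symm.app (SheafOfModules.over M f.opensRange)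
  let F : SheafOfModules.{u} (f.opensRange : Scheme.{u}).ringCatSheaf ⥤
      SheafOfModules.{u} (X.ringCatSheaf.over f.opensRange) := (overEquiv f.opensRange).inverse
  have : PreservesColimitsOfSize.{u, u} F :=
    (overEquiv f.opensRange).symm.toAdjunction.leftAdjoint_preservesColimits
  exact SheafOfModules.Presentation.ofIsIso.{u, u, u} e'.hom
    ((presentationOfIso e p).map F
      (TopologicalSpace.Opens.sheafOfModulesEquivOverInverseUnit _ _).symm)

end Local

namespace TwoCharts

open Scheme.Modules

variable {X : Scheme.{u}} {R₀ R₁ S : CommRingCat.{u}} (c : TwoCharts X R₀ R₁ S)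

include c in
/-- Quasi-coherence can be checked on the two charts. -/
lemma isQuasicoherent_of_restrict (M : X.Modules)
    [SheafOfModules.IsQuasicoherent.{u} (R := (Spec R₀).ringCatSheaf) (M.restrict c.j₀)]
    [SheafOfModules.IsQuasicoherent.{u} (R := (Spec R₁).ringCatSheaf) (M.restrict c.j₁)] :
    SheafOfModules.IsQuasicoherent.{u} (R := X.ringCatSheaf) M :=
  SheafOfModules.QuasicoherentData.isQuasicoherent (R := X.ringCatSheaf)
    { I := Bool
      X i := (match i with
        | true => c.j₀.opensRange
        | false => c.j₁.opensRange : X.Opens)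
      coversTop := by
        rw [Opens.coversTop_iff, TopologicalSpace.IsOpenCover, iSup_bool_eq]
        simpa using c.sup_eq
      presentation i := match i with
        | true => presentationOver c.j₀ M
        | false => presentationOver c.j₁ M }

/-- The property of being quasi-coherent, on the category of modules over a scheme. -/
abbrev _root_.qcohProperty (X : Scheme.{u}) : ObjectProperty X.Modules :=
  fun M => SheafOfModules.IsQuasicoherent.{u} (R := X.ringCatSheaf) M

/-- On an affine scheme, the quasi-coherent modules are the essential image of the fully faithful,
colimit-preserving functor `M ↦ M~`. -/
instance _root_.isClosedUnderColimits_qcohProperty_Spec (R : CommRingCat.{u}) (J : Type u)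
    [Category.{u} J] : (qcohProperty (Spec R)).IsClosedUnderColimitsOfShape J := by
  have h : (tilde.functor R).essImage = qcohProperty (Spec R) := essImage_tilde
  rw [← h]
  have h1 : (tilde.functor R).Full := inferInstance
  have h2 : (tilde.functor R).Faithful := inferInstance
  have h3 : PreservesColimitsOfShape J (tilde.functor R) := inferInstance
  infer_instance

include c in
lemma isClosedUnderColimits_qcohProperty (J : Type u) [Category.{u} J] :
    (qcohProperty X).IsClosedUnderColimitsOfShape J where
  colimitsOfShape_le M := by
    rintro ⟨p⟩
    have h₀ : qcohProperty (Spec R₀) (M.restrict c.j₀) :=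
      ObjectProperty.IsClosedUnderColimitsOfShape.colimitsOfShape_le (J := J) _ _
        ⟨{ toColimitPresentation := p.toColimitPresentation.map (restrictFunctor c.j₀)
           prop_diag_obj j := by
            have : qcohProperty X _ := p.prop_diag_obj j
            exact isQuasicoherent_restrictFunctor c.j₀ (p.diag.obj j) }⟩
    have h₁ : qcohProperty (Spec R₁) (M.restrict c.j₁) :=
      ObjectProperty.IsClosedUnderColimitsOfShape.colimitsOfShape_le (J := J) _ _
        ⟨{ toColimitPresentation := p.toColimitPresentation.map (restrictFunctor c.j₁)
           prop_diag_obj j := by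
            have : qcohProperty X _ := p.prop_diag_obj j
            exact isQuasicoherent_restrictFunctor c.j₁ (p.diag.obj j) }⟩
    exact c.isQuasicoherent_of_restrict M

include c in
lemma hasColimitsOfShape_QCoh (J : Type u) [Category.{u} J] : HasColimitsOfShape J (QCoh X) :=
  have := c.isClosedUnderColimits_qcohProperty J
  inferInstanceAs (HasColimitsOfShape J (qcohProperty X).FullSubcategory)

include c in
lemma preservesColimitsOfShape_ι (J : Type u) [Category.{u} J] :
    PreservesColimitsOfShape J (qcohProperty X).ι :=
  have := c.isClosedUnderColimits_qcohProperty J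
  inferInstance

include c in
/-- Sections of quasi-coherent modules over an affine chart commute with colimits. -/
lemma preservesColimitsOfShape_chartSections {R : CommRingCat.{u}} (f : Spec R ⟶ X)
    [IsOpenImmersion f] (J : Type u) [Category.{u} J] :
    PreservesColimitsOfShape J ((qcohProperty X).ι ⋙ chartSections f) := by
  have h1 := c.preservesColimitsOfShape_ι J
  let G : (qcohProperty X).FullSubcategory ⥤ (qcohProperty (Spec R)).FullSubcategory :=
    (qcohProperty (Spec R)).lift ((qcohProperty X).ι ⋙ restrictFunctor f) fun M =>
      have : qcohProperty X M.obj := M.property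
      isQuasicoherent_restrictFunctor f M.obj
  have h2 : PreservesColimitsOfShape J (G ⋙ (qcohProperty (Spec R)).ι) :=
    inferInstanceAs (PreservesColimitsOfShape J ((qcohProperty X).ι ⋙ restrictFunctor f))
  have h3 : PreservesColimitsOfShape J G :=
    preservesColimitsOfShape_of_reflects_of_preserves G (qcohProperty (Spec R)).ι
  let T : (qcohProperty (Spec R)).FullSubcategory ⥤ ModuleCat.{u} R :=
    (tildeEquiv (R := R)).inverse
  have h4 : PreservesColimitsOfShape J T :=
    have : (tildeEquiv (R := R)).inverse.IsEquivalence := inferInstance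
    have : PreservesColimitsOfShape J (tildeEquiv (R := R)).inverse := inferInstance
    this
  exact inferInstanceAs (PreservesColimitsOfShape J (G ⋙ T))

end TwoCharts

/-! ### Twists of the structure sheaf -/

section Representing

open Scheme.Modules

variable {X : Scheme.{u}}

/-- Sections over an open subset are corepresentable on `𝒪_X`-modules: the sheafification of the
free presheaf of modules on a representable presheaf does it. -/
lemma exists_corepresenting_sections (U : X.Opens) :
    ∃ (Z : X.Modules) (z : Γ(Z, U)), ∀ (M : X.Modules) (x : Γ(M, U)),
      ∃! f : Z ⟶ M, f.app U z = x := by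
  let F : PresheafOfModules.{u} X.ringCatSheaf.obj :=
    (PresheafOfModules.free _).obj (yoneda.obj U)
  let adj := PresheafOfModules.sheafificationAdjunction (𝟙 X.ringCatSheaf.obj)
  let Z : X.Modules := (PresheafOfModules.sheafification (𝟙 X.ringCatSheaf.obj)).obj F
  let z : Γ(Z, U) := PresheafOfModules.freeYonedaEquiv (adj.unit.app F)
  have key (M : X.Modules) : Function.Bijective (fun f : Z ⟶ M => f.app U z) := by
    have h : (fun f : Z ⟶ M => f.app U z) = (PresheafOfModules.freeYonedaEquiv ∘
        adj.homEquiv F M : (Z ⟶ M) → Γ(M, U)) := by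
      funext f
      have h1 : adj.homEquiv F M f = _ := Adjunction.homEquiv_unit _ _ _ f
      exact ((congrArg PresheafOfModules.freeYonedaEquiv h1).trans
        (PresheafOfModules.freeYonedaEquiv_comp _ _)).symm
    rw [h]
    exact (Equiv.bijective _).comp (Equiv.bijective _)
  exact ⟨Z, z, fun M x => (key M).existsUnique x⟩

end Representing

namespace TwoCharts

open Scheme.Modules

variable {X : Scheme.{u}} {R₀ R₁ S : CommRingCat.{u}} (c : TwoCharts X R₀ R₁ S)

/-- The module `P` with generators `e₀` over the first chart and `e₁` over the second, subject to
the single relation `e₀ = w e₁` on the intersection. -/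
lemma exists_twist (w : S) : ∃ (P : X.Modules) (e₀ : c.sec₀.obj P) (e₁ : c.sec₁.obj P),
    c.res₀ P e₀ = w • c.res₁ P e₁ ∧
    ∀ (M : X.Modules) (x₀ : c.sec₀.obj M) (x₁ : c.sec₁.obj M), c.res₀ M x₀ = w • c.res₁ M x₁ →
      ∃! f : P ⟶ M, c.sec₀.map f e₀ = x₀ ∧ c.sec₁.map f e₁ = x₁ := by
  obtain ⟨Z₀, z₀, h₀⟩ := exists_corepresenting_sections (c.j₀ ''ᵁ ⊤)
  obtain ⟨Z₁, z₁, h₁⟩ := exists_corepresenting_sections (c.j₁ ''ᵁ ⊤)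
  obtain ⟨Z, z, h⟩ := exists_corepresenting_sections (c.j₀₁ ''ᵁ ⊤)
  obtain ⟨p, hp, -⟩ := h Z₀ (c.res₀ Z₀ z₀)
  obtain ⟨q, hq, -⟩ := h Z₁ (w • c.res₁ Z₁ z₁ : c.sec₀₁.obj Z₁)
  have key {M : X.Modules} (f₀ : Z₀ ⟶ M) (f₁ : Z₁ ⟶ M) :
      p ≫ f₀ = q ≫ f₁ ↔ c.res₀ M (c.sec₀.map f₀ z₀) = w • c.res₁ M (c.sec₁.map f₁ z₁) := by
    have k₀ : (p ≫ f₀).app (c.j₀₁ ''ᵁ ⊤) z = c.res₀ M (c.sec₀.map f₀ z₀) :=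
      (congrArg (f₀.app _) hp).trans (chartRes_map c.comp₀ f₀ z₀).symm
    have k₁ : (q ≫ f₁).app (c.j₀₁ ''ᵁ ⊤) z = w • c.res₁ M (c.sec₁.map f₁ z₁) :=
      (congrArg (f₁.app _) hq).trans (((c.sec₀₁.map f₁).hom.map_smul w (c.res₁ Z₁ z₁)).trans
        (congrArg (w • ·) (chartRes_map c.comp₁ f₁ z₁).symm))
    rw [← k₀, ← k₁]
    exact ⟨fun e => by rw [e], fun e => (h M _).unique e rfl⟩
  refine ⟨pushout p q, c.sec₀.map (pushout.inl p q) z₀, c.sec₁.map (pushout.inr p q) z₁,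
    (key _ _).mp pushout.condition, fun M x₀ x₁ hx => ?_⟩
  obtain ⟨f₀, hf₀, hf₀'⟩ := h₀ M x₀
  obtain ⟨f₁, hf₁, hf₁'⟩ := h₁ M x₁
  have hcond : p ≫ f₀ = q ≫ f₁ := (key f₀ f₁).mpr (by
    have e₀ : c.sec₀.map f₀ z₀ = x₀ := hf₀
    have e₁ : c.sec₁.map f₁ z₁ = x₁ := hf₁
    rw [e₀, e₁, hx])
  refine ⟨pushout.desc f₀ f₁ hcond, ⟨?_, ?_⟩, fun g hg => ?_⟩
  · exact (congrArg (fun φ : Z₀ ⟶ M => φ.app (c.j₀ ''ᵁ ⊤) z₀) (pushout.inl_desc _ _ hcond)).trans hf₀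
  · exact (congrArg (fun φ : Z₁ ⟶ M => φ.app (c.j₁ ''ᵁ ⊤) z₁) (pushout.inr_desc _ _ hcond)).trans hf₁
  · apply pushout.hom_ext
    · exact (hf₀' (pushout.inl p q ≫ g) hg.1).trans (pushout.inl_desc _ _ hcond).symm
    · exact (hf₁' (pushout.inr p q ≫ g) hg.2).trans (pushout.inr_desc _ _ hcond).symm

end TwoCharts

/-! ### Quasi-coherence and finite presentation of twists -/

section

open Scheme.Modules

variable {X : Scheme.{u}} {R S : CommRingCat.{u}}

/-- A module that is generated over a chart by one section, freely as far as morphisms to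
pushforwards from that chart are concerned, is free of rank one, and hence quasi-coherent, over the
chart: by adjunction its restriction corepresents global sections, as the structure sheaf does. -/
lemma isQuasicoherent_restrict_of_existsUnique (f : Spec R ⟶ X) [IsOpenImmersion f]
    (P : X.Modules) (e : (chartSections f).obj P)
    (h : ∀ (N : (Spec R).Modules) (y : Γ(N, ⊤)), ∃! g : P ⟶ (pushforward f).obj N,
      g.app (f ''ᵁ ⊤) e = N.presheaf.map (homOfLE (le_top : f ⁻¹ᵁ (f ''ᵁ ⊤) ≤ ⊤)).op y) :
    SheafOfModules.IsQuasicoherent.{u} (R := (Spec R).ringCatSheaf) (P.restrict f) := by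
  have key (N : (Spec R).Modules) (y : Γ(N, ⊤)) :
      ∃! γ : P.restrict f ⟶ N, γ.app ⊤ e = y := by
    have hγ (γ : P.restrict f ⟶ N) : ((restrictAdjunction f).homEquiv P N γ).app (f ''ᵁ ⊤) e =
        N.presheaf.map (homOfLE (le_top : f ⁻¹ᵁ (f ''ᵁ ⊤) ≤ ⊤)).op (γ.app ⊤ e) := by
      have h1 := (restrictAdjunction f).homEquiv_unit P N γ
      refine (congrArg (fun φ : P ⟶ (pushforward f).obj N => φ.app (f ''ᵁ ⊤) e) h1).trans ?_
      exact app_presheaf_map γ (le_top : f ⁻¹ᵁ (f ''ᵁ ⊤) ≤ ⊤) e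
    have hinj : Function.Injective
        (N.presheaf.map (homOfLE (le_top : f ⁻¹ᵁ (f ''ᵁ ⊤) ≤ ⊤)).op) := by
      have h2 : (⊤ : (Spec R).Opens) ≤ f ⁻¹ᵁ (f ''ᵁ ⊤) := by simp
      exact Function.LeftInverse.injective (g := N.presheaf.map (homOfLE h2).op) fun x =>
        (presheaf_map_map N le_top h2 x).trans (presheaf_map_self N _ x)
    obtain ⟨g, hg, hg'⟩ := h N y
    refine ⟨((restrictAdjunction f).homEquiv P N).symm g, hinj ?_, fun γ hγy => ?_⟩
    · rw [← hγ, Equiv.apply_symm_apply]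
      exact hg
    · rw [Equiv.eq_symm_apply]
      exact hg' _ ((hγ γ).trans (congrArg _ hγy))
  let T : (Spec R).Modules := (tilde.functor R).obj (ModuleCat.of R R)
  let E (N : (Spec R).Modules) : (T ⟶ N) ≃ Γ(N, ⊤) :=
    ((tilde.adjunction (R := R)).homEquiv _ _).trans
      (ModuleCat.homEquiv.trans (LinearMap.ringLmapEquivSelf R ℕ
        ((moduleSpecΓFunctor (R := R)).obj N)).toEquiv)
  have hE {N N' : (Spec R).Modules} (φ : T ⟶ N) (ψ : N ⟶ N') :
      E N' (φ ≫ ψ) = ψ.app ⊤ (E N φ) := by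
    have := (tilde.adjunction (R := R)).homEquiv_naturality_right φ ψ
    exact congr(($this).hom (1 : R))
  let φ : T ⟶ P.restrict f := (E _).symm e
  have hφ : E _ φ = e := (E _).apply_symm_apply e
  obtain ⟨ψ, hψ, -⟩ := key T (E T (𝟙 T))
  have h1 : φ ≫ ψ = 𝟙 T := (E T).injective ((hE φ ψ).trans ((congrArg _ hφ).trans hψ))
  have h2 : ψ ≫ φ = 𝟙 _ := (key _ e).unique
    ((congrArg (φ.app ⊤) hψ).trans ((hE (𝟙 T) φ).symm.trans
      ((congrArg (E _) (Category.id_comp φ)).trans hφ))) rfl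
  have hT : qcohProperty (Spec R) T := inferInstanceAs
    (SheafOfModules.IsQuasicoherent.{u} (R := (Spec R).ringCatSheaf) (tilde (ModuleCat.of R R)))
  exact (SheafOfModules.isQuasicoherent (Spec R).ringCatSheaf).prop_of_iso
    (⟨φ, ψ, h1, h2⟩ : T ≅ P.restrict f) hT

/-- Restriction of sections of a pushforward along `f` from `U` to `V ≤ U` is bijective if `U` and
`V` have the same preimage under `f`. -/
lemma bijective_presheaf_map_pushforward {Y : Scheme.{u}} (f : Y ⟶ X) (N : Y.Modules)
    {U V : X.Opens} (h : V ≤ U) (h' : f ⁻¹ᵁ U ≤ f ⁻¹ᵁ V) :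
    Function.Bijective (((pushforward f).obj N).presheaf.map (homOfLE h).op) := by
  rw [Function.bijective_iff_has_inverse]
  exact ⟨N.presheaf.map (homOfLE h').op,
    fun x => (presheaf_map_map N (f.preimage_mono h) h' x).trans (presheaf_map_self N _ x),
    fun x => (presheaf_map_map N h' (f.preimage_mono h) x).trans (presheaf_map_self N _ x)⟩

end

namespace TwoCharts

open Scheme.Modules

variable {X : Scheme.{u}} {R₀ R₁ S : CommRingCat.{u}} (c : TwoCharts X R₀ R₁ S)

/-- If the transition function `w` is a unit, then the module with generators `e₀` and `e₁` and the
relation `e₀ = w e₁` is quasi-coherent. -/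
lemma exists_qcoh_twist (w : Sˣ) : ∃ (P : QCoh X) (e₀ : c.sec₀.obj P.obj) (e₁ : c.sec₁.obj P.obj),
    c.res₀ P.obj e₀ = (w : S) • c.res₁ P.obj e₁ ∧
    ∀ (M : X.Modules) (x₀ : c.sec₀.obj M) (x₁ : c.sec₁.obj M),
      c.res₀ M x₀ = (w : S) • c.res₁ M x₁ →
      ∃! f : P.obj ⟶ M, c.sec₀.map f e₀ = x₀ ∧ c.sec₁.map f e₁ = x₁ := by
  obtain ⟨P, e₀, e₁, he, hP⟩ := c.exists_twist w
  have he' {M : X.Modules} (f : P ⟶ M) :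
      c.res₀ M (c.sec₀.map f e₀) = (w : S) • c.res₁ M (c.sec₁.map f e₁) := by
    refine (chartRes_map c.comp₀ f e₀).trans ?_
    rw [he]
    refine ((c.sec₀₁.map f).hom.map_smul _ _).trans ?_
    exact congrArg ((w : S) • ·) (chartRes_map c.comp₁ f e₁).symm
  refine ⟨⟨P, ?_⟩, e₀, e₁, he, hP⟩
  -- On a module pushed forward from the first chart, restriction from the second chart to the
  -- intersection is bijective, so the section over the second chart is determined by the first one.
  have i₀ := isQuasicoherent_restrict_of_existsUnique c.j₀ P e₀ fun N y => by
    let M : X.Modules := (pushforward c.j₀).obj N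
    have hb : Function.Bijective (c.res₁ M) :=
      bijective_presheaf_map_pushforward c.j₀ N (image_top_le_of_comp_eq c.comp₁)
        (fun z hz => c.inf_le ⟨⟨z, trivial, rfl⟩, hz⟩)
    let x₀ : c.sec₀.obj M :=
      N.presheaf.map (homOfLE (le_top : c.j₀ ⁻¹ᵁ (c.j₀ ''ᵁ ⊤) ≤ ⊤)).op y
    obtain ⟨x₁, hx₁⟩ := hb.2 ((↑w⁻¹ : S) • c.res₀ M x₀)
    have hx : c.res₀ M x₀ = (w : S) • c.res₁ M x₁ := by
      rw [hx₁, smul_smul, Units.mul_inv, one_smul]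
    obtain ⟨f, hf, hf'⟩ := hP M x₀ x₁ hx
    refine ⟨f, hf.1, fun g (hg : c.sec₀.map g e₀ = x₀) => hf' g ⟨hg, hb.1 ?_⟩⟩
    have := he' g
    rw [hg, hx] at this
    exact (w.isUnit.smul_left_cancel.mp this).symm
  have i₁ := isQuasicoherent_restrict_of_existsUnique c.j₁ P e₁ fun N y => by
    let M : X.Modules := (pushforward c.j₁).obj N
    have hb : Function.Bijective (c.res₀ M) :=
      bijective_presheaf_map_pushforward c.j₁ N (image_top_le_of_comp_eq c.comp₀)
        (fun z hz => c.inf_le ⟨hz, ⟨z, trivial, rfl⟩⟩)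
    let x₁ : c.sec₁.obj M :=
      N.presheaf.map (homOfLE (le_top : c.j₁ ⁻¹ᵁ (c.j₁ ''ᵁ ⊤) ≤ ⊤)).op y
    obtain ⟨x₀, hx₀⟩ := hb.2 ((w : S) • c.res₁ M x₁)
    obtain ⟨f, hf, hf'⟩ := hP M x₀ x₁ hx₀
    refine ⟨f, hf.2, fun g (hg : c.sec₁.map g e₁ = x₁) => hf' g ⟨hb.1 ?_, hg⟩⟩
    rw [he' g, hg, hx₀]
  exact c.isQuasicoherent_of_restrict P

section FilteredColimits

variable {R : CommRingCat.{u}} (f : Spec R ⟶ X) [IsOpenImmersion f] {J : Type u}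
  [Category.{u} J] [IsFiltered J] {D : J ⥤ QCoh X} {t : Cocone D} (ht : IsColimit t)

include c ht

lemma exists_chartSections_map_eq (x : (chartSections f).obj t.pt.obj) :
    ∃ (j : J) (y : (chartSections f).obj (D.obj j).obj),
      (chartSections f).map (t.ι.app j).hom y = x := by
  have := c.preservesColimitsOfShape_chartSections f J
  exact Types.jointly_surjective_of_isColimit
    (isColimitOfPreserves (((qcohProperty X).ι ⋙ chartSections f) ⋙ forget _) ht) x

lemma exists_chartSections_map_eq_map {j : J} (x y : (chartSections f).obj (D.obj j).obj)
    (h : (chartSections f).map (t.ι.app j).hom x = (chartSections f).map (t.ι.app j).hom y) :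
    ∃ (k : J) (i : j ⟶ k),
      (chartSections f).map (D.map i).hom x = (chartSections f).map (D.map i).hom y := by
  have := c.preservesColimitsOfShape_chartSections f J
  exact (Types.FilteredColimit.isColimit_eq_iff' (isColimitOfPreserves
    (((qcohProperty X).ι ⋙ chartSections f) ⋙ forget _) ht) x y).mp h

end FilteredColimits

lemma sec_map_comp {R : CommRingCat.{u}} (f : Spec R ⟶ X) [IsOpenImmersion f]
    {A B C : X.Modules} (g : A ⟶ B) (h : B ⟶ C) (x : (chartSections f).obj A) :
    (chartSections f).map (g ≫ h) x = (chartSections f).map h ((chartSections f).map g x) := rfl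

/-- A twist is finitely presented: a morphism out of it is a pair of sections satisfying one
equation, and sections over the charts commute with direct limits. -/
lemma isFinitelyPresentable_of_existsUnique (w : S) (P : QCoh X) (e₀ : c.sec₀.obj P.obj)
    (e₁ : c.sec₁.obj P.obj) (he : c.res₀ P.obj e₀ = w • c.res₁ P.obj e₁)
    (hP : ∀ (M : X.Modules) (x₀ : c.sec₀.obj M) (x₁ : c.sec₁.obj M),
      c.res₀ M x₀ = w • c.res₁ M x₁ →
      ∃! f : P.obj ⟶ M, c.sec₀.map f e₀ = x₀ ∧ c.sec₁.map f e₁ = x₁) :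
    IsFinitelyPresentable.{u} P := by
  have he' {M : X.Modules} (f : P.obj ⟶ M) :
      c.res₀ M (c.sec₀.map f e₀) = w • c.res₁ M (c.sec₁.map f e₁) := by
    refine (chartRes_map c.comp₀ f e₀).trans ?_
    rw [he]
    refine ((c.sec₀₁.map f).hom.map_smul _ _).trans ?_
    exact congrArg (w • ·) (chartRes_map c.comp₁ f e₁).symm
  have huniq {M : X.Modules} (f g : P.obj ⟶ M) (h₀ : c.sec₀.map f e₀ = c.sec₀.map g e₀)
      (h₁ : c.sec₁.map f e₁ = c.sec₁.map g e₁) : f = g :=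
    (hP M _ _ (he' f)).unique ⟨rfl, rfl⟩ ⟨h₀.symm, h₁.symm⟩
  rw [isFinitelyPresentable_iff_preservesFilteredColimits]
  refine ⟨fun J _ _ => ⟨fun {D} => ⟨fun {t} ht =>
    ⟨Types.FilteredColimit.isColimitOf' _ _ (fun (f : P ⟶ t.pt) => ?_)
      (fun i (f g : P ⟶ D.obj i) hfg => ?_)⟩⟩⟩⟩
  · obtain ⟨j₀, y₀, hy₀⟩ := c.exists_chartSections_map_eq c.j₀ ht (c.sec₀.map f.hom e₀)
    obtain ⟨j₁, y₁, hy₁⟩ := c.exists_chartSections_map_eq c.j₁ ht (c.sec₁.map f.hom e₁)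
    let j := IsFiltered.max j₀ j₁
    have w₀ : D.map (IsFiltered.leftToMax j₀ j₁) ≫ t.ι.app j = t.ι.app j₀ := t.w _
    have w₁ : D.map (IsFiltered.rightToMax j₀ j₁) ≫ t.ι.app j = t.ι.app j₁ := t.w _
    let z₀ := c.sec₀.map (D.map (IsFiltered.leftToMax j₀ j₁)).hom y₀
    let z₁ := c.sec₁.map (D.map (IsFiltered.rightToMax j₀ j₁)).hom y₁
    have hz₀ : c.sec₀.map (t.ι.app j).hom z₀ = c.sec₀.map f.hom e₀ := by
      rw [← hy₀, ← w₀]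
      rfl
    have hz₁ : c.sec₁.map (t.ι.app j).hom z₁ = c.sec₁.map f.hom e₁ := by
      rw [← hy₁, ← w₁]
      rfl
    obtain ⟨k, i, hk⟩ := c.exists_chartSections_map_eq_map c.j₀₁ ht
      (c.res₀ (D.obj j).obj z₀) (w • c.res₁ (D.obj j).obj z₁) (by
        refine (chartRes_map c.comp₀ _ z₀).symm.trans ?_
        refine Eq.trans ?_ ((c.sec₀₁.map (t.ι.app j).hom).hom.map_smul _ _).symm
        refine Eq.trans ?_ (congrArg (w • ·) (chartRes_map c.comp₁ (t.ι.app j).hom z₁))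
        rw [hz₀]
        exact (he' f.hom).trans (congrArg (fun x => w • c.res₁ _ x) hz₁.symm))
    obtain ⟨g, hg, -⟩ := hP (D.obj k).obj (c.sec₀.map (D.map i).hom z₀)
      (c.sec₁.map (D.map i).hom z₁) (by
        refine (chartRes_map c.comp₀ _ z₀).trans (hk.trans ?_)
        refine ((c.sec₀₁.map (D.map i).hom).hom.map_smul _ _).trans ?_
        exact congrArg (w • ·) (chartRes_map c.comp₁ (D.map i).hom z₁).symm)
    have wi : D.map i ≫ t.ι.app k = t.ι.app j := t.w _
    refine ⟨k, ObjectProperty.homMk g, ?_⟩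
    change f = ObjectProperty.homMk g ≫ t.ι.app k
    ext1
    refine huniq _ _ ?_ ?_
    · refine hz₀.symm.trans (Eq.trans ?_ (congrArg (c.sec₀.map (t.ι.app k).hom) hg.1).symm)
      rw [← wi]
      rfl
    · refine hz₁.symm.trans (Eq.trans ?_ (congrArg (c.sec₁.map (t.ι.app k).hom) hg.2).symm)
      rw [← wi]
      rfl
  · have hfg' : f ≫ t.ι.app i = g ≫ t.ι.app i := hfg
    have e : f.hom ≫ (t.ι.app i).hom = g.hom ≫ (t.ι.app i).hom := congrArg (·.hom) hfg'
    obtain ⟨k, p, hp⟩ := c.exists_chartSections_map_eq_map c.j₀ ht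
      (c.sec₀.map f.hom e₀) (c.sec₀.map g.hom e₀) (by
        rw [← sec_map_comp, ← sec_map_comp, e])
    have wp : (D.map p).hom ≫ (t.ι.app k).hom = (t.ι.app i).hom := congrArg (·.hom) (t.w p)
    have e' : (f.hom ≫ (D.map p).hom) ≫ (t.ι.app k).hom =
        (g.hom ≫ (D.map p).hom) ≫ (t.ι.app k).hom := by
      rw [Category.assoc, Category.assoc, wp, e]
    obtain ⟨l, q, hq⟩ := c.exists_chartSections_map_eq_map c.j₁ ht
      (c.sec₁.map (f.hom ≫ (D.map p).hom) e₁) (c.sec₁.map (g.hom ≫ (D.map p).hom) e₁)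
      (by rw [← sec_map_comp, ← sec_map_comp, e'])
    refine ⟨l, p ≫ q, ?_⟩
    have key : f ≫ D.map (p ≫ q) = g ≫ D.map (p ≫ q) := by
      rw [D.map_comp, ← Category.assoc, ← Category.assoc]
      ext1
      exact huniq _ _ (congrArg (c.sec₀.map (D.map q).hom) hp) hq
    exact key

end TwoCharts

/-! ### c-pure-exact sequences on charts -/

lemma LinearMap.exists_factor_of_surjective {R A B C : Type*} [Ring R] [AddCommGroup A]
    [AddCommGroup B] [AddCommGroup C] [Module R A] [Module R B] [Module R C] (g : A →ₗ[R] B)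
    (h : A →ₗ[R] C) (hg : Function.Surjective g) (hh : ∀ x, g x = 0 → h x = 0) :
    ∃ l : B →ₗ[R] C, ∀ x, l (g x) = h x := by
  refine ⟨(ker g).liftQ h (fun x hx => mem_ker.mpr (hh x (mem_ker.mp hx))) ∘ₗ
    (g.quotKerEquivOfSurjective hg).symm, fun x => ?_⟩
  have : (g.quotKerEquivOfSurjective hg).symm (g x) = Submodule.Quotient.mk x := by
    rw [LinearEquiv.symm_apply_eq]
    rfl
  rw [coe_comp, Function.comp_apply, LinearEquiv.coe_coe, this]
  exact Submodule.liftQ_apply _ _ _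

namespace TwoCharts

open Scheme.Modules

variable {X : Scheme.{u}} {R₀ R₁ S : CommRingCat.{u}} (c : TwoCharts X R₀ R₁ S)

/-- Exchange the two charts. -/
def swap : TwoCharts X R₁ R₀ S where
  j₀ := c.j₁
  j₁ := c.j₀
  j₀₁ := c.j₀₁
  a := c.b
  b := c.a
  open₀ := c.open₁
  open₁ := c.open₀
  open₀₁ := c.open₀₁
  comp₀ := c.comp₁
  comp₁ := c.comp₀
  sup_eq := sup_comm (c.j₁ ''ᵁ ⊤) (c.j₀ ''ᵁ ⊤) ▸ c.sup_eq
  inf_le := inf_comm (c.j₁ ''ᵁ ⊤) (c.j₀ ''ᵁ ⊤) ▸ c.inf_le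
  t := c.s
  s := c.t
  image₀ := c.image₁
  image₁ := c.image₀
  isUnit_a := c.isUnit_b
  isUnit_b := c.isUnit_a

lemma res₀_map {M N : X.Modules} (g : M ⟶ N) (x : c.sec₀.obj M) :
    c.res₀ N (c.sec₀.map g x) = c.sec₀₁.map g (c.res₀ M x) := chartRes_map c.comp₀ g x

lemma res₁_map {M N : X.Modules} (g : M ⟶ N) (x : c.sec₁.obj M) :
    c.res₁ N (c.sec₁.map g x) = c.sec₀₁.map g (c.res₁ M x) := chartRes_map c.comp₁ g x

section Pure

variable {E : ShortComplex (QCoh X)} (hE : IsCPureExact E)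

include hE

/-- Sections of twists lift along the epimorphism of a c-pure-exact sequence. -/
lemma exists_twist_lift (w : Sˣ) (x₀ : c.sec₀.obj E.X₃.obj) (x₁ : c.sec₁.obj E.X₃.obj)
    (hx : c.res₀ _ x₀ = (w : S) • c.res₁ _ x₁) :
    ∃ (y₀ : c.sec₀.obj E.X₂.obj) (y₁ : c.sec₁.obj E.X₂.obj),
      c.res₀ _ y₀ = (w : S) • c.res₁ _ y₁ ∧
        c.sec₀.map E.g.hom y₀ = x₀ ∧ c.sec₁.map E.g.hom y₁ = x₁ := by
  obtain ⟨P, e₀, e₁, he, hP⟩ := c.exists_qcoh_twist w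
  have hfp := c.isFinitelyPresentable_of_existsUnique w P e₀ e₁ he hP
  obtain ⟨φ, hφ, -⟩ := hP _ x₀ x₁ hx
  have h := (AddCommGrpCat.epi_iff_surjective _).mp (hE.2 P hfp).epi_g
  obtain ⟨ψ, hψ⟩ := h (ObjectProperty.homMk φ : P ⟶ E.X₃)
  have hψ' : ψ ≫ E.g = ObjectProperty.homMk φ := hψ
  have hψ'' : ψ.hom ≫ E.g.hom = φ := congrArg (·.hom) hψ'
  refine ⟨c.sec₀.map ψ.hom e₀, c.sec₁.map ψ.hom e₁, ?_, ?_, ?_⟩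
  · rw [c.res₀_map, he, c.res₁_map, _root_.map_smul]
  · rw [← sec_map_comp, hψ'', hφ.1]
  · rw [← sec_map_comp, hψ'', hφ.2]

/-- A section of a twist of the middle term that dies in the quotient comes from the subobject, as a
morphism out of a twist does. -/
lemma exists_twist_preimage (w : Sˣ) (x₀ : c.sec₀.obj E.X₂.obj) (x₁ : c.sec₁.obj E.X₂.obj)
    (hx : c.res₀ _ x₀ = (w : S) • c.res₁ _ x₁) (h₀ : c.sec₀.map E.g.hom x₀ = 0)
    (h₁ : c.sec₁.map E.g.hom x₁ = 0) :
    ∃ y₀ : c.sec₀.obj E.X₁.obj, c.sec₀.map E.f.hom y₀ = x₀ := by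
  obtain ⟨P, e₀, e₁, he, hP⟩ := c.exists_qcoh_twist w
  have hfp := c.isFinitelyPresentable_of_existsUnique w P e₀ e₁ he hP
  obtain ⟨φ, hφ, -⟩ := hP _ x₀ x₁ hx
  have h := (ShortComplex.ab_exact_iff _).mp (hE.2 P hfp).exact
  have hz : φ ≫ E.g.hom = 0 := (hP _ 0 0 (by simp)).unique
    ⟨by rw [sec_map_comp, hφ.1, h₀], by rw [sec_map_comp, hφ.2, h₁]⟩ ⟨rfl, rfl⟩
  obtain ⟨ψ, hψ⟩ := h (ObjectProperty.homMk φ : P ⟶ E.X₂) (by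
    have : (ObjectProperty.homMk φ : P ⟶ E.X₂) ≫ E.g = 0 := by
      ext1
      exact hz
    exact this)
  have hψ' : ψ ≫ E.f = ObjectProperty.homMk φ := hψ
  have hψ'' : ψ.hom ≫ E.f.hom = φ := congrArg (·.hom) hψ'
  exact ⟨c.sec₀.map ψ.hom e₀, by rw [← sec_map_comp, hψ'', hφ.1]⟩

/-- A section of a twist of the subobject that dies in the middle term is zero, as a morphism out of
a twist is. -/
lemma eq_zero_of_twist (w : Sˣ) (x₀ : c.sec₀.obj E.X₁.obj) (x₁ : c.sec₁.obj E.X₁.obj)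
    (hx : c.res₀ _ x₀ = (w : S) • c.res₁ _ x₁) (h₀ : c.sec₀.map E.f.hom x₀ = 0)
    (h₁ : c.sec₁.map E.f.hom x₁ = 0) : x₀ = 0 := by
  obtain ⟨P, e₀, e₁, he, hP⟩ := c.exists_qcoh_twist w
  obtain ⟨φ, hφ, -⟩ := hP _ x₀ x₁ hx
  have hz : φ ≫ E.f.hom = 0 := (hP _ 0 0 (by simp)).unique
    ⟨by rw [sec_map_comp, hφ.1, h₀], by rw [sec_map_comp, hφ.2, h₁]⟩ ⟨rfl, rfl⟩
  have hm := hE.1.mono_f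
  have h : (ObjectProperty.homMk φ : P ⟶ E.X₁) = 0 := by
    rw [← cancel_mono E.f, zero_comp]
    ext1
    exact hz
  have h' : φ = 0 := congrArg (·.hom) h
  rw [← hφ.1, h']
  rfl

end Pure

section Extend

variable (M : X.Modules) [SheafOfModules.IsQuasicoherent.{u} (R := X.ringCatSheaf) M]

/-- A section over the first chart extends to a section of a sufficiently high twist; if it is
killed by a morphism, then the extension can be taken to be killed as well. -/
lemma exists_twist_extension {N : X.Modules}
    [SheafOfModules.IsQuasicoherent.{u} (R := X.ringCatSheaf) N] (g : M ⟶ N)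
    (x₀ : c.sec₀.obj M) (hx₀ : c.sec₀.map g x₀ = 0) :
    ∃ (w : Sˣ) (x₁ : c.sec₁.obj M), c.res₀ M x₀ = (w : S) • c.res₁ M x₁ ∧
      c.sec₁.map g x₁ = 0 := by
  obtain ⟨n, x₁, hx₁⟩ := exists_chartRes_eq_pow_smul c.comp₁ c.image₁ M rfl (c.res₀ M x₀)
  have hz : c.res₁ N (c.sec₁.map g x₁) = 0 := by
    rw [c.res₁_map, hx₁, _root_.map_smul, ← c.res₀_map, hx₀, _root_.map_zero, smul_zero]
  obtain ⟨m, hm⟩ := exists_pow_smul_eq_zero c.comp₁ c.image₁ N rfl _ hz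
  obtain ⟨w, hw⟩ := c.isUnit_b
  refine ⟨(w ^ (m + n))⁻¹, c.s ^ m • x₁, ?_, by rw [_root_.map_smul, hm]⟩
  rw [LinearMap.map_smulₛₗ, hx₁, map_pow, ← hw, smul_smul, smul_smul, mul_assoc, ← pow_add,
    ← Units.val_pow_eq_pow_val, Units.inv_mul, one_smul]

end Extend

section Exact

variable {E : ShortComplex (QCoh X)} (hE : IsCPureExact E)

include hE

lemma sec₀_map_injective : Function.Injective (c.sec₀.map E.f.hom) := by
  have := E.X₁.property
  have := E.X₂.property
  refine (injective_iff_map_eq_zero (c.sec₀.map E.f.hom).hom).mpr fun x hx => ?_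
  obtain ⟨w, x₁, h, h'⟩ := c.exists_twist_extension _ E.f.hom x hx
  exact c.eq_zero_of_twist hE w x x₁ h hx h'

lemma sec₀_map_surjective : Function.Surjective (c.sec₀.map E.g.hom) := by
  intro x
  have := E.X₃.property
  obtain ⟨w, x₁, h, h'⟩ := c.exists_twist_extension _ (0 : E.X₃.obj ⟶ E.X₃.obj) x rfl
  obtain ⟨y₀, y₁, -, hy, -⟩ := c.exists_twist_lift hE w x x₁ h
  exact ⟨y₀, hy⟩

lemma exists_sec₀_map_eq (x : c.sec₀.obj E.X₂.obj) (hx : c.sec₀.map E.g.hom x = 0) :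
    ∃ y, c.sec₀.map E.f.hom y = x := by
  have := E.X₂.property
  have := E.X₃.property
  obtain ⟨w, x₁, h, h'⟩ := c.exists_twist_extension _ E.g.hom x hx
  exact c.exists_twist_preimage hE w x x₁ h hx h'

lemma sec₁_map_surjective : Function.Surjective (c.sec₁.map E.g.hom) :=
  c.swap.sec₀_map_surjective hE

lemma exists_sec₁_map_eq (x : c.sec₁.obj E.X₂.obj) (hx : c.sec₁.map E.g.hom x = 0) :
    ∃ y, c.sec₁.map E.f.hom y = x :=
  c.swap.exists_sec₀_map_eq hE x hx

lemma sec₀₁_map_injective : Function.Injective (c.sec₀₁.map E.f.hom) := by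
  have := E.X₁.property
  have := E.X₂.property
  refine (injective_iff_map_eq_zero (c.sec₀₁.map E.f.hom).hom).mpr fun y hy => ?_
  replace hy : c.sec₀₁.map E.f.hom y = 0 := hy
  obtain ⟨n, x, hx⟩ := exists_chartRes_eq_pow_smul c.comp₀ c.image₀ E.X₁.obj rfl y
  obtain ⟨m, hm⟩ := exists_pow_smul_eq_zero c.comp₀ c.image₀ E.X₂.obj rfl
    (c.sec₀.map E.f.hom x) (by rw [c.res₀_map, hx, _root_.map_smul, hy, smul_zero])
  have hm' : c.t ^ m • x = 0 := c.sec₀_map_injective hE (by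
    rw [_root_.map_smul, hm, _root_.map_zero])
  have h : c.a.hom c.t ^ (m + n) • y = 0 := by
    rw [pow_add, mul_smul, ← hx, ← map_pow, ← LinearMap.map_smulₛₗ, hm', _root_.map_zero]
  exact ((c.isUnit_a.pow (m + n)).smul_eq_zero).mp h

lemma sec₀₁_map_surjective : Function.Surjective (c.sec₀₁.map E.g.hom) := by
  intro y
  have := E.X₃.property
  obtain ⟨n, x, hx⟩ := exists_chartRes_eq_pow_smul c.comp₀ c.image₀ E.X₃.obj rfl y
  obtain ⟨z, rfl⟩ := c.sec₀_map_surjective hE x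
  obtain ⟨w, hw⟩ := c.isUnit_a.pow n
  refine ⟨(↑w⁻¹ : S) • c.res₀ _ z, ?_⟩
  rw [_root_.map_smul, ← c.res₀_map, hx, ← hw, smul_smul, Units.inv_mul, one_smul]

lemma exists_sec₀₁_map_eq (y : c.sec₀₁.obj E.X₂.obj) (hy : c.sec₀₁.map E.g.hom y = 0) :
    ∃ z, c.sec₀₁.map E.f.hom z = y := by
  have := E.X₂.property
  have := E.X₃.property
  obtain ⟨n, x, hx⟩ := exists_chartRes_eq_pow_smul c.comp₀ c.image₀ E.X₂.obj rfl y
  obtain ⟨m, hm⟩ := exists_pow_smul_eq_zero c.comp₀ c.image₀ E.X₃.obj rfl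
    (c.sec₀.map E.g.hom x) (by rw [c.res₀_map, hx, _root_.map_smul, hy, smul_zero])
  obtain ⟨z, hz⟩ := c.exists_sec₀_map_eq hE (c.t ^ m • x) (by rw [_root_.map_smul, hm])
  obtain ⟨w, hw⟩ := c.isUnit_a.pow (m + n)
  refine ⟨(↑w⁻¹ : S) • c.res₀ _ z, ?_⟩
  rw [_root_.map_smul, ← c.res₀_map, hz, LinearMap.map_smulₛₗ, hx, map_pow, smul_smul (_ ^ m),
    ← pow_add, ← hw, smul_smul, Units.inv_mul, one_smul]

/-- The monomorphism of a c-pure-exact sequence induces an injection on the first Čech cohomology of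
every twist, because the sections of every twist of the quotient lift. -/
lemma exists_eq_res_add_res (w : Sˣ) (y : c.sec₀₁.obj E.X₁.obj) (b₀ : c.sec₀.obj E.X₂.obj)
    (b₁ : c.sec₁.obj E.X₂.obj)
    (hy : c.sec₀₁.map E.f.hom y = c.res₀ _ b₀ + (w : S) • c.res₁ _ b₁) :
    ∃ a₀ a₁, y = c.res₀ _ a₀ + (w : S) • c.res₁ _ a₁ := by
  have hz : E.f.hom ≫ E.g.hom = 0 := congrArg (·.hom) E.zero
  have h0 : c.res₀ _ (c.sec₀.map E.g.hom b₀) + (w : S) • c.res₁ _ (c.sec₁.map E.g.hom b₁) = 0 := by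
    rw [c.res₀_map, c.res₁_map, ← _root_.map_smul, ← map_add, ← hy, ← sec_map_comp, hz]
    rfl
  obtain ⟨β₀, β₁, hβ, hβ₀, hβ₁⟩ := c.exists_twist_lift hE w (c.sec₀.map E.g.hom b₀)
    (-c.sec₁.map E.g.hom b₁) (by rw [map_neg, smul_neg]; exact eq_neg_of_add_eq_zero_left h0)
  obtain ⟨a₀, ha₀⟩ := c.exists_sec₀_map_eq hE (b₀ - β₀) (by rw [map_sub, hβ₀, sub_self])
  obtain ⟨a₁, ha₁⟩ := c.exists_sec₁_map_eq hE (b₁ + β₁) (by rw [map_add, hβ₁, add_neg_cancel])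
  refine ⟨a₀, a₁, c.sec₀₁_map_injective hE ?_⟩
  rw [hy, map_add, _root_.map_smul, ← c.res₀_map, ← c.res₁_map, ha₀, ha₁, map_sub, map_add, hβ,
    smul_add]
  abel

include c in
/-- A morphism that vanishes on the subobject of a c-pure-exact sequence factors through the
quotient. -/
lemma exists_factor {N : X.Modules} (h : E.X₂.obj ⟶ N) (hh : E.f.hom ≫ h = 0) :
    ∃ h' : E.X₃.obj ⟶ N, E.g.hom ≫ h' = h := by
  have := E.X₂.property
  have := E.X₃.property
  have z {R : CommRingCat.{u}} (f : Spec R ⟶ X) [IsOpenImmersion f]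
      (y : (chartSections f).obj E.X₁.obj) :
      (chartSections f).map h ((chartSections f).map E.f.hom y) = 0 := by
    rw [← sec_map_comp, hh]
    rfl
  obtain ⟨l₀, hl₀⟩ := LinearMap.exists_factor_of_surjective (c.sec₀.map E.g.hom).hom
    (c.sec₀.map h).hom (c.sec₀_map_surjective hE) fun x hx => by
      obtain ⟨y, rfl⟩ := c.exists_sec₀_map_eq hE x hx
      exact z c.j₀ y
  obtain ⟨l₁, hl₁⟩ := LinearMap.exists_factor_of_surjective (c.sec₁.map E.g.hom).hom
    (c.sec₁.map h).hom (c.sec₁_map_surjective hE) fun x hx => by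
      obtain ⟨y, rfl⟩ := c.exists_sec₁_map_eq hE x hx
      exact z c.j₁ y
  obtain ⟨l, hl⟩ := LinearMap.exists_factor_of_surjective (c.sec₀₁.map E.g.hom).hom
    (c.sec₀₁.map h).hom (c.sec₀₁_map_surjective hE) fun x hx => by
      obtain ⟨y, rfl⟩ := c.exists_sec₀₁_map_eq hE x hx
      exact z c.j₀₁ y
  replace hl₀ (x) : l₀ (c.sec₀.map E.g.hom x) = c.sec₀.map h x := hl₀ x
  replace hl₁ (x) : l₁ (c.sec₁.map E.g.hom x) = c.sec₁.map h x := hl₁ x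
  replace hl (x) : l (c.sec₀₁.map E.g.hom x) = c.sec₀₁.map h x := hl x
  obtain ⟨h', h₀, h₁⟩ := c.exists_hom l₀ l₁ l (fun x => by
      obtain ⟨z, rfl⟩ := c.sec₀_map_surjective hE x
      rw [hl₀, c.res₀_map, c.res₀_map, hl]) (fun x => by
      obtain ⟨z, rfl⟩ := c.sec₁_map_surjective hE x
      rw [hl₁, c.res₁_map, c.res₁_map, hl])
  exact ⟨h', c.hom_ext (fun x => by rw [sec_map_comp, h₀, hl₀])
    (fun x => by rw [sec_map_comp, h₁, hl₁])⟩

end Exact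

include c in
/-- To prove c-pure-injectivity, it is enough to extend morphisms along the monomorphism of a
c-pure-exact sequence. -/
lemma isCPureInjective_of_exists_extension (N : QCoh X)
    (hN : ∀ E : ShortComplex (QCoh X), IsCPureExact E → ∀ φ : E.X₁.obj ⟶ N.obj,
      ∃ ψ : E.X₂.obj ⟶ N.obj, E.f.hom ≫ ψ = φ) : IsCPureInjective N := by
  intro E hE
  have hepi := hE.1.epi_g
  refine ShortComplex.ShortExact.mk' ?_ ?_ ?_
  · rw [ShortComplex.ab_exact_iff]
    intro (h : E.X₂ ⟶ N) hh
    have hh' : E.f ≫ h = 0 := hh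
    obtain ⟨h', hh''⟩ := c.exists_factor hE h.hom (congrArg (·.hom) hh')
    refine ⟨(ObjectProperty.homMk h' : E.X₃ ⟶ N), ?_⟩
    have : E.g ≫ ObjectProperty.homMk h' = h := by
      ext1
      exact hh''
    exact this
  · rw [AddCommGrpCat.mono_iff_injective]
    intro (h : E.X₃ ⟶ N) (h' : E.X₃ ⟶ N) hhh
    exact (cancel_epi E.g).mp hhh
  · rw [AddCommGrpCat.epi_iff_surjective]
    intro (φ : E.X₁ ⟶ N)
    obtain ⟨ψ, hψ⟩ := hN E hE φ.hom
    refine ⟨(ObjectProperty.homMk ψ : E.X₂ ⟶ N), ?_⟩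
    have : E.f ≫ ObjectProperty.homMk ψ = φ := by
      ext1
      exact hψ
    exact this

end TwoCharts

/-! ### Residues and modules over Laurent polynomials -/

section LinearAlgebra

/-- A semilinear map lifts through an injective one that has a larger range. -/
lemma LinearMap.exists_lift_of_range_le {R S A B C : Type*} [Ring R] [Ring S] {σ : R →+* S}
    [AddCommGroup A] [AddCommGroup B] [AddCommGroup C] [Module R A] [Module R B] [Module S C]
    (f : A →ₛₗ[σ] C) (g : B →ₛₗ[σ] C) (hf : Function.Injective f)
    (h : ∀ x, ∃ y, f y = g x) : ∃ l : B →ₗ[R] A, ∀ x, f (l x) = g x := by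
  choose l hl using h
  exact ⟨{ toFun := l
           map_add' := fun x y => hf (by simp [hl])
           map_smul' := fun r x => hf (by simp [hl]) }, hl⟩

lemma Module.Basis.repr_apply_of_semilinear {R S A B I : Type*} [Semiring R] [Semiring S]
    {σ : R →+* S} [AddCommMonoid A] [AddCommMonoid B] [Module R A] [Module S B]
    (e : Module.Basis I R A) (e' : Module.Basis I S B) (f : A →ₛₗ[σ] B) (h : ∀ i, f (e i) = e' i)
    (x : A) (i : I) : e'.repr (f x) i = σ (e.repr x i) := by
  classical
  have hx : x = ∑ j ∈ (e.repr x).support, e.repr x j • e j :=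
    (e.linearCombination_repr x).symm
  conv_lhs => rw [hx]
  rw [map_sum, map_sum, Finsupp.finsetSum_apply]
  simp only [map_smulₛₗ, h, Finsupp.smul_apply, Basis.repr_self, smul_eq_mul,
    Finsupp.single_apply, RingHom.id_apply]
  rw [Finset.sum_eq_single i (fun j _ hj => by simp [hj])]
  · simp
  · intro hi
    simp [Finsupp.notMem_support_iff.mp hi]

/-- Over a field, a linear map on `A` extends along `f : A → B` to a linear map killing a subspace `W`
of `B`, provided that it kills the preimage of `W`. -/
lemma LinearMap.exists_extend_of_forall_mem {k A B V : Type*} [Field k] [AddCommGroup A]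
    [AddCommGroup B] [AddCommGroup V] [Module k A] [Module k B] [Module k V] (f : A →ₗ[k] B)
    (W : Submodule k B) (l : A →ₗ[k] V) (h : ∀ a, f a ∈ W → l a = 0) :
    ∃ l' : B →ₗ[k] V, (∀ a, l' (f a) = l a) ∧ ∀ b ∈ W, l' b = 0 := by
  let q : A →ₗ[k] B ⧸ W := W.mkQ ∘ₗ f
  obtain ⟨m, hm⟩ := LinearMap.exists_factor_of_surjective q.rangeRestrict l
    q.surjective_rangeRestrict (fun a ha => h a (by
      have : q a = 0 := congrArg Subtype.val ha
      simpa [q] using this))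
  obtain ⟨m', hm'⟩ := m.exists_extend
  refine ⟨m' ∘ₗ W.mkQ, fun a => ?_, fun b hb => ?_⟩
  · rw [← hm, ← hm']
    rfl
  · have : W.mkQ b = 0 := by simpa using hb
    rw [coe_comp, Function.comp_apply, this, map_zero]

end LinearAlgebra

section Laurent

open LaurentPolynomial

variable {k : Type*} [Field k]

lemma LaurentPolynomial.coeff_T_mul (n m : ℤ) (p : k[T;T⁻¹]) :
    (T n * p).coeff m = p.coeff (m - n) := by
  have := p.coeff_single_mul_eq_mul_coeff (r := (1 : k)) (m := n) (m₁ := m) (m - n)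
    (fun a _ => by constructor <;> intro h <;> lia)
  rw [T, this, one_mul]

lemma LaurentPolynomial.coeff_toLaurent_of_neg (p : Polynomial k) {n : ℤ} (hn : n < 0) :
    (Polynomial.toLaurent p).coeff n = 0 := by
  rw [← Finsupp.notMem_support_iff, LaurentPolynomial.support_coeff_toLaurent]
  simp only [Finset.mem_map, not_exists]
  rintro m ⟨-, rfl⟩
  simp at hn
  lia

variable {M N V : Type*} [AddCommGroup M] [AddCommGroup N] [AddCommGroup V] [Module k V]
  [Module k M] [Module k N] [Module k[T;T⁻¹] M] [Module k[T;T⁻¹] N]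
  [IsScalarTower k k[T;T⁻¹] M] [IsScalarTower k k[T;T⁻¹] N]

lemma LaurentPolynomial.C_mul_T_smul (r : k) (n : ℤ) (y : M) :
    (C r * T n : k[T;T⁻¹]) • y = r • (T n : k[T;T⁻¹]) • y := by
  rw [← smul_eq_C_mul, smul_assoc]

/-- If a `k`-linear map `l` to `V` kills almost all the shifts `T ^ m • y` of each element `y`, then
it is the residue of a `k[T;T⁻¹]`-linear map: the coefficient of `T ^ j` in the value at `y` is the
residue at the shift of `y` by `T ^ (-1 - j)`. -/
lemma exists_linearMap_of_residue (i : V →ₗ[k] N) (l : M →ₗ[k] V)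
    (hl : ∀ y, {j : ℤ | l ((T (-1 - j) : k[T;T⁻¹]) • y) ≠ 0}.Finite) :
    ∃ Φ : M →ₗ[k[T;T⁻¹]] N, ∀ y, Φ y = ∑ᶠ j : ℤ, (T j : k[T;T⁻¹]) •
      i (l ((T (-1 - j) : k[T;T⁻¹]) • y)) := by
  have hfin (y : M) : Function.HasFiniteSupport fun j : ℤ => (T j : k[T;T⁻¹]) •
      i (l ((T (-1 - j) : k[T;T⁻¹]) • y)) := by
    refine (hl y).subset fun j hj hj' => hj ?_
    simp only [hj', map_zero, smul_zero]
  let F : M →+ N := AddMonoidHom.mk' (fun y => ∑ᶠ j : ℤ, (T j : k[T;T⁻¹]) •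
      i (l ((T (-1 - j) : k[T;T⁻¹]) • y))) fun x y => by
    rw [← finsum_add_distrib (hfin x) (hfin y)]
    simp only [smul_add, map_add]
  have hk (r : k) (y : M) : F (r • y) = r • F y := by
    change ∑ᶠ j : ℤ, _ = r • ∑ᶠ j : ℤ, _
    rw [smul_finsum]
    refine finsum_congr fun j => ?_
    rw [smul_comm (T (-1 - j) : k[T;T⁻¹]) r y, map_smul, map_smul, smul_comm]
  have hT (n : ℤ) (y : M) : F ((T n : k[T;T⁻¹]) • y) = (T n : k[T;T⁻¹]) • F y := by
    change ∑ᶠ j : ℤ, _ = (T n : k[T;T⁻¹]) • ∑ᶠ j : ℤ, _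
    rw [smul_finsum' _ (hfin y), ← finsum_comp_equiv (Equiv.addRight n)]
    refine finsum_congr fun j => ?_
    simp only [Equiv.coe_addRight, smul_smul, ← T_add]
    rw [show -1 - (j + n) + n = -1 - j by ring, add_comm]
  refine ⟨{ F with map_smul' := fun p y => ?_ }, fun y => rfl⟩
  induction p using LaurentPolynomial.induction_on' with
  | add p q hp hq =>
    change F ((p + q) • y) = (p + q) • F y
    rw [add_smul, add_smul, map_add]
    exact congrArg₂ _ hp hq
  | C_mul_T n r =>
    change F _ = (C r * T n : k[T;T⁻¹]) • F y
    rw [LaurentPolynomial.C_mul_T_smul, LaurentPolynomial.C_mul_T_smul, hk, hT]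

variable {I : Type*} (e : Module.Basis I k[T;T⁻¹] N)

/-- The coordinatewise coefficient of `T⁻¹` on a free module over Laurent polynomials. -/
def basisResidue : N →ₗ[k] (I →₀ k) :=
  Finsupp.mapRange.linearMap
    ({ toFun := fun p => p.coeff (-1)
       map_add' := fun p q => by simp
       map_smul' := fun r p => by simp } : k[T;T⁻¹] →ₗ[k] k) ∘ₗ
    e.repr.toLinearMap.restrictScalars k

lemma basisResidue_apply (z : N) (i : I) : basisResidue e z i = (e.repr z i).coeff (-1) := rfl

lemma basisResidue_T_smul (j : ℤ) (z : N) (i : I) :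
    basisResidue e ((T (-1 - j) : k[T;T⁻¹]) • z) i = (e.repr z i).coeff j := by
  rw [basisResidue_apply, map_smul, Finsupp.smul_apply, smul_eq_mul, coeff_T_mul]
  congr 1
  ring

/-- An element of a free module over Laurent polynomials is recovered from the residues of its
shifts. -/
lemma finsum_T_smul_basisResidue (z : N) :
    ∑ᶠ j : ℤ, (T j : k[T;T⁻¹]) • Finsupp.linearCombination k e
      (basisResidue e ((T (-1 - j) : k[T;T⁻¹]) • z)) = z := by
  classical
  have hfin (y : N) : {j : ℤ | basisResidue e ((T (-1 - j) : k[T;T⁻¹]) • y) ≠ 0}.Finite := by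
    refine ((e.repr y).support.biUnion fun i => (e.repr y i).coeff.support).finite_toSet.subset
      fun j hj => ?_
    obtain ⟨i, hi⟩ := DFunLike.ne_iff.mp hj
    rw [basisResidue_T_smul] at hi
    simp only [Finset.coe_biUnion, Set.mem_iUnion]
    refine ⟨i, Finsupp.mem_support_iff.mpr fun h => hi ?_, Finsupp.mem_support_iff.mpr hi⟩
    rw [h]
    rfl
  obtain ⟨Φ, hΦ⟩ := exists_linearMap_of_residue (Finsupp.linearCombination k e)
    (basisResidue e) hfin
  have h : Φ = LinearMap.id := e.ext fun i => by
    rw [hΦ, finsum_eq_single _ 0]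
    · have : basisResidue e ((T (-1 - 0) : k[T;T⁻¹]) • e i) = Finsupp.single i 1 := by
        ext i'
        rw [basisResidue_T_smul, e.repr_self]
        by_cases hi : i = i'
        · subst hi
          simp
        · simp [hi]
      rw [this]
      simp
    · intro j hj
      have : basisResidue e ((T (-1 - j) : k[T;T⁻¹]) • e i) = 0 := by
        ext i'
        rw [basisResidue_T_smul, e.repr_self]
        by_cases hi : i = i'
        · subst hi
          rw [Finsupp.single_eq_same, ← T_zero, T_apply, if_neg (Ne.symm hj)]
          rfl
        · simp [hi]
      rw [this, map_zero, smul_zero]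
  rw [← hΦ, h]
  rfl

end Laurent

/-! ### Sections over the standard charts -/

namespace TwoCharts

open Scheme.Modules LaurentPolynomial

variable {k : Type u} [Field k] {X : Scheme.{u}}
  (c : TwoCharts X (.of (Polynomial k)) (.of (Polynomial k)) (.of k[T;T⁻¹]))

/-- The gluing data of the projective line: the coordinate of the first chart is `T` on the
intersection, and the coordinate of the second one is `T⁻¹`. -/
structure IsStandard : Prop where
  a_apply (p : Polynomial k) : c.a.hom p = p.toLaurent
  b_apply (p : Polynomial k) : c.b.hom p = invert p.toLaurent
  t_eq : c.t = (Polynomial.X : Polynomial k)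
  s_eq : c.s = (Polynomial.X : Polynomial k)

/-- Compatible bases of the sections of a module over the two charts and their intersection, for
which the transition function is a power of the coordinate. -/
structure MonomialBases (N : X.Modules) (I : Type*) (n : ℤ) where
  /-- A basis over the first chart. -/
  e₀ : Module.Basis I (Polynomial k) (c.sec₀.obj N)
  /-- A basis over the second chart. -/
  e₁ : Module.Basis I (Polynomial k) (c.sec₁.obj N)
  /-- A basis over the intersection of the charts. -/
  e₀₁ : Module.Basis I k[T;T⁻¹] (c.sec₀₁.obj N)
  res₀_e₀ (i : I) : c.res₀ N (e₀ i) = e₀₁ i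
  res₁_e₁ (i : I) : (T n : k[T;T⁻¹]) • c.res₁ N (e₁ i) = e₀₁ i

variable {c} (hc : c.IsStandard)

namespace MonomialBases

variable {N : X.Modules} {I : Type*} {n : ℤ} (B : MonomialBases c N I n)

include hc B

lemma repr_res₀ (z : c.sec₀.obj N) (i : I) :
    B.e₀₁.repr (c.res₀ N z) i = (B.e₀.repr z i).toLaurent :=
  (Module.Basis.repr_apply_of_semilinear B.e₀ B.e₀₁ (c.res₀ N) B.res₀_e₀ z i).trans
    (hc.a_apply _)

lemma repr_res₁ (z : c.sec₁.obj N) (i : I) :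
    B.e₀₁.repr ((T n : k[T;T⁻¹]) • c.res₁ N z) i = invert (B.e₁.repr z i).toLaurent :=
  (Module.Basis.repr_apply_of_semilinear B.e₁ B.e₀₁
    ((T n : (CommRingCat.of k[T;T⁻¹])) • c.res₁ N) B.res₁_e₁ z i).trans (hc.b_apply _)

lemma res₀_injective : Function.Injective (c.res₀ N) := by
  intro x y hxy
  refine B.e₀.ext_elem fun i => Polynomial.toLaurent_injective ?_
  rw [← B.repr_res₀ hc, ← B.repr_res₀ hc, hxy]

lemma res₁_injective : Function.Injective (c.res₁ N) := by
  intro x y hxy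
  refine B.e₁.ext_elem fun i => Polynomial.toLaurent_injective (invert.injective ?_)
  rw [← B.repr_res₁ hc, ← B.repr_res₁ hc, hxy]

end MonomialBases

section Residue

variable {M : X.Modules}

include hc

lemma res₀_X_pow_smul (m : ℕ) (x : c.sec₀.obj M) :
    c.res₀ M ((Polynomial.X ^ m : Polynomial k) • x) = (T m : k[T;T⁻¹]) • c.res₀ M x := by
  refine ((c.res₀ M).map_smulₛₗ _ _).trans (congrArg (fun p : k[T;T⁻¹] => p • c.res₀ M x) ?_)
  exact (hc.a_apply _).trans (by simp)

lemma res₁_X_pow_smul (m : ℕ) (x : c.sec₁.obj M) :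
    c.res₁ M ((Polynomial.X ^ m : Polynomial k) • x) = (T (-m) : k[T;T⁻¹]) • c.res₁ M x := by
  refine ((c.res₁ M).map_smulₛₗ _ _).trans (congrArg (fun p : k[T;T⁻¹] => p • c.res₁ M x) ?_)
  exact (hc.b_apply _).trans (by simp)

lemma res₀_C_smul (r : k) (x : c.sec₀.obj M) :
    c.res₀ M ((Polynomial.C r : Polynomial k) • x) =
      (LaurentPolynomial.C r : k[T;T⁻¹]) • c.res₀ M x := by
  refine ((c.res₀ M).map_smulₛₗ _ _).trans (congrArg (fun p : k[T;T⁻¹] => p • c.res₀ M x) ?_)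
  exact (hc.a_apply _).trans (by simp)

lemma res₁_C_smul (r : k) (x : c.sec₁.obj M) :
    c.res₁ M ((Polynomial.C r : Polynomial k) • x) =
      (LaurentPolynomial.C r : k[T;T⁻¹]) • c.res₁ M x := by
  refine ((c.res₁ M).map_smulₛₗ _ _).trans (congrArg (fun p : k[T;T⁻¹] => p • c.res₁ M x) ?_)
  exact (hc.b_apply _).trans (by simp)

/-- Shifting by a high power of `T` makes a section over the intersection extend to the first
chart. -/
lemma exists_res₀_eq [SheafOfModules.IsQuasicoherent.{u} (R := X.ringCatSheaf) M]
    (y : c.sec₀₁.obj M) : ∃ (m : ℕ) (x : c.sec₀.obj M), (T m : k[T;T⁻¹]) • y = c.res₀ M x := by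
  obtain ⟨m, x, hx⟩ := exists_chartRes_eq_pow_smul c.comp₀ c.image₀ M rfl y
  refine ⟨m, x, Eq.trans ?_ hx.symm⟩
  refine congrArg (fun p : k[T;T⁻¹] => p • y) ?_
  rw [hc.t_eq]
  refine Eq.trans ?_ (congrArg (fun p : k[T;T⁻¹] => p ^ m) (hc.a_apply _)).symm
  simp

/-- Shifting by a high power of `T⁻¹` makes a section over the intersection extend to the second
chart. -/
lemma exists_res₁_eq [SheafOfModules.IsQuasicoherent.{u} (R := X.ringCatSheaf) M]
    (y : c.sec₀₁.obj M) : ∃ (m : ℕ) (x : c.sec₁.obj M), (T (-m) : k[T;T⁻¹]) • y = c.res₁ M x := by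
  obtain ⟨m, x, hx⟩ := exists_chartRes_eq_pow_smul c.comp₁ c.image₁ M rfl y
  refine ⟨m, x, Eq.trans ?_ hx.symm⟩
  refine congrArg (fun p : k[T;T⁻¹] => p • y) ?_
  rw [hc.s_eq]
  refine Eq.trans ?_ (congrArg (fun p : k[T;T⁻¹] => p ^ m) (hc.b_apply _)).symm
  simp

end Residue

end TwoCharts

/-! ### Extending morphisms by extending residues -/

section Laurent

open LaurentPolynomial

variable {k : Type*} [Field k] {M M' N : Type*} [AddCommGroup M] [AddCommGroup M']
  [AddCommGroup N] [Module k M] [Module k M'] [Module k N] [Module k[T;T⁻¹] M]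
  [Module k[T;T⁻¹] M'] [Module k[T;T⁻¹] N] [IsScalarTower k k[T;T⁻¹] M]
  [IsScalarTower k k[T;T⁻¹] M'] [IsScalarTower k k[T;T⁻¹] N] {I : Type*}

/-- Extension of a linear map `φ` to a free module over Laurent polynomials along `f`, by extending
its residue as a linear map over the field `k`. The extension `l` of the residue is chosen to kill
`W₀ ⊔ W₁`, which contains almost all the shifts of each element. -/
lemma exists_extension_of_residue (e : Module.Basis I k[T;T⁻¹] N) (f : M →ₗ[k[T;T⁻¹]] M')
    (φ : M →ₗ[k[T;T⁻¹]] N) (W₀ W₁ : Submodule k M')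
    (h : ∀ a, f a ∈ W₀ ⊔ W₁ → basisResidue e (φ a) = 0)
    (h₀ : ∀ y, ∃ m : ℤ, ∀ j, m ≤ j → (T j : k[T;T⁻¹]) • y ∈ W₀)
    (h₁ : ∀ y, ∃ m : ℤ, ∀ j, j ≤ m → (T j : k[T;T⁻¹]) • y ∈ W₁) :
    ∃ (Φ : M' →ₗ[k[T;T⁻¹]] N) (l : M' →ₗ[k] (I →₀ k)), (∀ a, Φ (f a) = φ a) ∧
      (∀ b ∈ W₀ ⊔ W₁, l b = 0) ∧ ∀ y, Φ y = ∑ᶠ j : ℤ, (T j : k[T;T⁻¹]) •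
        Finsupp.linearCombination k e (l ((T (-1 - j) : k[T;T⁻¹]) • y)) := by
  obtain ⟨l, hl, hW⟩ := LinearMap.exists_extend_of_forall_mem (f.restrictScalars k) (W₀ ⊔ W₁)
    (basisResidue e ∘ₗ φ.restrictScalars k) h
  obtain ⟨Φ, hΦ⟩ := exists_linearMap_of_residue (Finsupp.linearCombination k e) l (fun y => by
    obtain ⟨m₀, hm₀⟩ := h₀ y
    obtain ⟨m₁, hm₁⟩ := h₁ y
    refine (Set.finite_Icc (-1 - m₀) (-1 - m₁)).subset fun j hj => ?_
    by_contra hj'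
    rw [Set.mem_Icc, not_and_or] at hj'
    refine hj (hW _ ?_)
    rcases hj' with hj' | hj'
    · exact Submodule.mem_sup_left (hm₀ _ (by lia))
    · exact Submodule.mem_sup_right (hm₁ _ (by lia)))
  refine ⟨Φ, l, fun a => ?_, hW, hΦ⟩
  rw [hΦ, ← finsum_T_smul_basisResidue e (φ a)]
  refine finsum_congr fun j => ?_
  rw [← f.map_smul, ← φ.map_smul]
  exact congrArg (fun v => (T j : k[T;T⁻¹]) • Finsupp.linearCombination k e v) (hl _)

end Laurent

namespace TwoCharts

open Scheme.Modules LaurentPolynomial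

variable {k : Type u} [Field k] {X : Scheme.{u}}
  {c : TwoCharts X (.of (Polynomial k)) (.of (Polynomial k)) (.of k[T;T⁻¹])} (hc : c.IsStandard)
  {N : X.Modules} {I : Type*} {n : ℤ} (B : MonomialBases c N I n)

namespace MonomialBases

include hc B

/-- The multiples of the basis `e₀₁` by nonnegative powers of `T` extend to the first chart. -/
lemma exists_res₀_eq_T_smul {m : ℤ} (hm : 0 ≤ m) (v : I →₀ k) [Module k (c.sec₀₁.obj N)]
    [IsScalarTower k k[T;T⁻¹] (c.sec₀₁.obj N)] :
    ∃ z, c.res₀ N z = (T m : k[T;T⁻¹]) • Finsupp.linearCombination k B.e₀₁ v := by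
  lift m to ℕ using hm
  induction v using Finsupp.induction_linear with
  | zero => exact ⟨0, by simp⟩
  | add v w hv hw =>
    obtain ⟨z, hz⟩ := hv
    obtain ⟨z', hz'⟩ := hw
    exact ⟨z + z', by rw [map_add, map_add, smul_add, hz, hz']⟩
  | single i r =>
    refine ⟨(Polynomial.X ^ m : Polynomial k) • (Polynomial.C r : Polynomial k) • B.e₀ i, ?_⟩
    rw [res₀_X_pow_smul hc, res₀_C_smul hc, B.res₀_e₀, Finsupp.linearCombination_single,
      C_eq_algebraMap, algebraMap_smul]

/-- The multiples of the basis `e₀₁` by powers of `T` of exponent at most `-n` extend to the second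
chart. -/
lemma exists_res₁_eq_T_smul {m : ℤ} (hm : m ≤ -n) (v : I →₀ k) [Module k (c.sec₀₁.obj N)]
    [IsScalarTower k k[T;T⁻¹] (c.sec₀₁.obj N)] :
    ∃ z, c.res₁ N z = (T m : k[T;T⁻¹]) • Finsupp.linearCombination k B.e₀₁ v := by
  induction v using Finsupp.induction_linear with
  | zero => exact ⟨0, by simp⟩
  | add v w hv hw =>
    obtain ⟨z, hz⟩ := hv
    obtain ⟨z', hz'⟩ := hw
    exact ⟨z + z', by rw [map_add, map_add, smul_add, hz, hz']⟩
  | single i r =>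
    obtain ⟨l, hl⟩ := Int.eq_ofNat_of_zero_le (show 0 ≤ -n - m by lia)
    refine ⟨(Polynomial.X ^ l : Polynomial k) • (Polynomial.C r : Polynomial k) • B.e₁ i, ?_⟩
    rw [res₁_X_pow_smul hc, res₁_C_smul hc, Finsupp.linearCombination_single, ← B.res₁_e₁,
      C_eq_algebraMap, algebraMap_smul, smul_comm (T m : k[T;T⁻¹]) r,
      smul_smul (T m : k[T;T⁻¹]), ← T_add, smul_comm]
    congr 3
    lia

/-- Sections over the first chart involve no negative powers of `T`. -/
lemma basisResidue_res₀ [Module k (c.sec₀₁.obj N)]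
    [IsScalarTower k k[T;T⁻¹] (c.sec₀₁.obj N)] (z : c.sec₀.obj N) :
    basisResidue B.e₀₁ (c.res₀ N z) = 0 := by
  ext i
  rw [basisResidue_apply, B.repr_res₀ hc, coeff_toLaurent_of_neg _ (by lia)]
  rfl

/-- Sections over the second chart involve only powers of `T` of exponent at most `-n`, so that their
products with `T ^ (n - 2)` have no term in `T⁻¹`. -/
lemma basisResidue_res₁ [Module k (c.sec₀₁.obj N)]
    [IsScalarTower k k[T;T⁻¹] (c.sec₀₁.obj N)] (z : c.sec₁.obj N) :
    basisResidue B.e₀₁ ((T (n - 2) : k[T;T⁻¹]) • c.res₁ N z) = 0 := by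
  ext i
  have : (T (n - 2) : k[T;T⁻¹]) • c.res₁ N z =
      (T (-1 - 1) : k[T;T⁻¹]) • (T n : k[T;T⁻¹]) • c.res₁ N z := by
    rw [smul_smul, ← T_add]
    congr 2
    lia
  rw [this, basisResidue_T_smul, B.repr_res₁ hc, invert_apply, coeff_toLaurent_of_neg _ (by lia)]
  rfl

/-- Morphisms to a module with monomial bases extend along the monomorphism of a c-pure-exact
sequence. The residue of `φ` kills the sections over the first chart and the shifts by `T ^ (n - 2)`
of the sections over the second one; it can be extended to the middle term of the sequence with the
same property, because the map on the first Čech cohomology of the twist is injective. The morphism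
with the extended residue maps sections over the charts to sections over the charts. -/
theorem exists_extension {E : ShortComplex (QCoh X)} (hE : IsCPureExact E)
    (φ : E.X₁.obj ⟶ N) : ∃ ψ : E.X₂.obj ⟶ N, E.f.hom ≫ ψ = φ := by
  have := E.X₁.property
  have := E.X₂.property
  let S := CommRingCat.of k[T;T⁻¹]
  let m₁ : Module k (c.sec₀₁.obj E.X₁.obj) := Module.compHom _ (algebraMap k k[T;T⁻¹])
  let m₂ : Module k (c.sec₀₁.obj E.X₂.obj) := Module.compHom _ (algebraMap k k[T;T⁻¹])
  let m : Module k (c.sec₀₁.obj N) := Module.compHom _ (algebraMap k k[T;T⁻¹])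
  have : IsScalarTower k k[T;T⁻¹] (c.sec₀₁.obj E.X₁.obj) := .of_compHom _ _ _
  have : IsScalarTower k k[T;T⁻¹] (c.sec₀₁.obj E.X₂.obj) := .of_compHom _ _ _
  have : IsScalarTower k k[T;T⁻¹] (c.sec₀₁.obj N) := .of_compHom _ _ _
  -- `W₀ ⊔ W₁` is the space of Čech coboundaries of a twist of the middle term.
  let W₀ : Submodule k (c.sec₀₁.obj E.X₂.obj) :=
    { carrier := Set.range (c.res₀ E.X₂.obj)
      add_mem' := by
        rintro _ _ ⟨x, rfl⟩ ⟨y, rfl⟩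
        exact ⟨x + y, map_add _ x y⟩
      zero_mem' := ⟨0, map_zero _⟩
      smul_mem' := by
        rintro r _ ⟨x, rfl⟩
        exact ⟨(Polynomial.C r : Polynomial k) • x, res₀_C_smul hc r x⟩ }
  let W₁ : Submodule k (c.sec₀₁.obj E.X₂.obj) :=
    { carrier := Set.range fun x => (T (n - 2) : k[T;T⁻¹]) • c.res₁ E.X₂.obj x
      add_mem' := by
        rintro _ _ ⟨x, rfl⟩ ⟨y, rfl⟩
        exact ⟨x + y, by simp only [map_add, smul_add]⟩
      zero_mem' := ⟨0, by simp only [map_zero, smul_zero]⟩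
      smul_mem' := by
        rintro r _ ⟨x, rfl⟩
        refine ⟨(Polynomial.C r : Polynomial k) • x, ?_⟩
        simp only [res₁_C_smul hc]
        rw [C_eq_algebraMap, algebraMap_smul, smul_comm] }
  have hW₀ (x : c.sec₀.obj E.X₂.obj) (j : ℤ) (hj : 0 ≤ j) :
      (T j : k[T;T⁻¹]) • c.res₀ _ x ∈ W₀ := by
    lift j to ℕ using hj
    exact ⟨_, res₀_X_pow_smul hc j x⟩
  have hW₁ (x : c.sec₁.obj E.X₂.obj) (j : ℤ) (hj : j ≤ n - 2) :
      (T j : k[T;T⁻¹]) • c.res₁ _ x ∈ W₁ := by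
    obtain ⟨l, hl⟩ := Int.eq_ofNat_of_zero_le (show 0 ≤ n - 2 - j by lia)
    refine ⟨(Polynomial.X ^ l : Polynomial k) • x, ?_⟩
    simp only [res₁_X_pow_smul hc]
    rw [smul_smul, ← T_add]
    congr 2
    lia
  obtain ⟨Φ, l, hΦ, hl, hsum⟩ := exists_extension_of_residue B.e₀₁
    (c.sec₀₁.map E.f.hom).hom (c.sec₀₁.map φ).hom W₀ W₁ (fun a ha => by
      obtain ⟨_, ⟨b₀, rfl⟩, _, ⟨b₁, rfl⟩, hb⟩ := Submodule.mem_sup.mp ha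
      obtain ⟨a₀, a₁, rfl⟩ := c.exists_eq_res_add_res hE (isUnit_T (n - 2)).unit a b₀ b₁ hb.symm
      have h1 : c.sec₀₁.map φ (c.res₀ _ a₀ + (T (n - 2) : S) • c.res₁ _ a₁) =
          c.res₀ _ (c.sec₀.map φ a₀) + (T (n - 2) : S) • c.res₁ _ (c.sec₁.map φ a₁) := by
        rw [map_add, _root_.map_smul, c.res₀_map, c.res₁_map]
      refine (congrArg (basisResidue B.e₀₁) h1).trans ?_
      rw [map_add, B.basisResidue_res₀ hc]
      exact (zero_add _).trans (B.basisResidue_res₁ hc _))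
    (fun y => by
      obtain ⟨m, x, hx⟩ := exists_res₀_eq hc y
      refine ⟨m, fun j hj => ?_⟩
      have e : (T j : k[T;T⁻¹]) • y = (T (j - m) : k[T;T⁻¹]) • c.res₀ _ x := by
        rw [← hx, smul_smul, ← T_add, Int.sub_add_cancel]
      exact e ▸ hW₀ x (j - m) (by omega))
    (fun y => by
      obtain ⟨m, x, hx⟩ := exists_res₁_eq hc y
      refine ⟨n - 2 - m, fun j hj => ?_⟩
      have e : (T j : k[T;T⁻¹]) • y = (T (j + m) : k[T;T⁻¹]) • c.res₁ _ x := by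
        rw [← hx, smul_smul, ← T_add, Int.add_neg_cancel_right]
      exact e ▸ hW₁ x (j + m) (by omega))
  -- The residue kills `W₀`, so only nonnegative powers of `T` occur in the image of a section over
  -- the first chart.
  have h₀ (x : c.sec₀.obj E.X₂.obj) : ∃ z, c.res₀ N z = Φ (c.res₀ _ x) := by
    rw [hsum]
    refine finsum_induction (fun y => ∃ z, c.res₀ N z = y) ⟨0, map_zero _⟩ ?_ fun j => ?_
    · rintro _ _ ⟨x, rfl⟩ ⟨y, rfl⟩
      exact ⟨x + y, map_add _ x y⟩
    · by_cases hj : 0 ≤ j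
      · exact B.exists_res₀_eq_T_smul hc hj _
      · refine ⟨0, ?_⟩
        rw [hl _ (Submodule.mem_sup_left (hW₀ x _ (by omega)))]
        simp
  -- The residue kills `W₁`, so only exponents up to `-n` occur in the image of a section over the
  -- second chart.
  have h₁ (x : c.sec₁.obj E.X₂.obj) : ∃ z, c.res₁ N z = Φ (c.res₁ _ x) := by
    rw [hsum]
    refine finsum_induction (fun y => ∃ z, c.res₁ N z = y) ⟨0, map_zero _⟩ ?_ fun j => ?_
    · rintro _ _ ⟨x, rfl⟩ ⟨y, rfl⟩
      exact ⟨x + y, map_add _ x y⟩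
    · by_cases hj : j ≤ -n
      · exact B.exists_res₁_eq_T_smul hc hj _
      · refine ⟨0, ?_⟩
        rw [hl _ (Submodule.mem_sup_right (hW₁ x _ (by omega)))]
        simp
  let Φ' : c.sec₀₁.obj E.X₂.obj →ₗ[S] c.sec₀₁.obj N := Φ
  obtain ⟨g₀, hg₀⟩ := LinearMap.exists_lift_of_range_le (c.res₀ N)
    (Φ'.comp (c.res₀ E.X₂.obj)) (B.res₀_injective hc) h₀
  obtain ⟨g₁, hg₁⟩ := LinearMap.exists_lift_of_range_le (c.res₁ N)
    (Φ'.comp (c.res₁ E.X₂.obj)) (B.res₁_injective hc) h₁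
  obtain ⟨ψ, hψ₀, hψ₁⟩ := c.exists_hom g₀ g₁ Φ' hg₀ hg₁
  refine ⟨ψ, c.hom_ext (fun x => B.res₀_injective hc ?_) (fun x => B.res₁_injective hc ?_)⟩
  · rw [sec_map_comp, hψ₀, c.res₀_map]
    refine (hg₀ _).trans ((congrArg Φ (c.res₀_map E.f.hom x)).trans (hΦ _))
  · rw [sec_map_comp, hψ₁, c.res₁_map]
    refine (hg₁ _).trans ((congrArg Φ (c.res₁_map E.f.hom x)).trans (hΦ _))

end MonomialBases

end TwoCharts

/-! ### Sections of line bundles over affine charts -/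

/-- A module over a principal ideal domain that is locally free of rank one is free of rank
one. -/
lemma nonempty_basis_of_localization_span {R M : Type*} [CommRing R] [IsDomain R]
    [IsPrincipalIdealRing R] [AddCommGroup M] [Module R M] (t : Set R) (ht : Ideal.span t = ⊤)
    (h0 : ∀ g : t, g.val ≠ 0)
    {Mₚ : t → Type*} [∀ g, AddCommGroup (Mₚ g)] [∀ g, Module R (Mₚ g)]
    {Rₚ : t → Type*} [∀ g, CommRing (Rₚ g)] [∀ g, Algebra R (Rₚ g)]
    [∀ g : t, IsLocalization.Away g.val (Rₚ g)]
    [∀ g, Module (Rₚ g) (Mₚ g)] [∀ g, IsScalarTower R (Rₚ g) (Mₚ g)]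
    (f : ∀ g, M →ₗ[R] Mₚ g) [hf : ∀ g : t, IsLocalizedModule.Away g.val (f g)]
    (H : ∀ g, Nonempty (Module.Basis PUnit.{1} (Rₚ g) (Mₚ g))) :
    Nonempty (Module.Basis PUnit.{1} R M) := by
  have b := fun g => (H g).some
  -- A finitely generated torsion-free module over a principal ideal domain is free.
  have : Module.Finite R M := Module.Finite.of_localizationSpan' t ht (Rₚ := Rₚ) f
    fun g => Module.Finite.of_basis (b g)
  have hnz (g : t) : Submonoid.powers g.val ≤ nonZeroDivisors R :=
    powers_le_nonZeroDivisors_of_noZeroDivisors (h0 g)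
  have hdom (g : t) : IsDomain (Rₚ g) := IsLocalization.isDomain_of_le_nonZeroDivisors _ (hnz g)
  have : Module.IsTorsionFree R M := .of_smul_eq_zero fun r m hrm => by
    by_contra! hne
    refine hne.2 (Module.eq_zero_of_isLocalized_span t ht Mₚ f m fun g => ?_)
    have h1 : algebraMap R (Rₚ g) r • f g m = 0 := by
      rw [algebraMap_smul, ← map_smul, hrm, map_zero]
    have h2 : algebraMap R (Rₚ g) r ≠ 0 := fun h => hne.1
      (IsLocalization.injective (Rₚ g) (hnz g) (h.trans (map_zero _).symm))
    refine (b g).ext_elem fun i => ?_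
    have h3 := congr((b g).repr $h1 i)
    rw [(b g).repr.map_smul, Finsupp.smul_apply, (b g).repr.map_zero,
      Finsupp.zero_apply, smul_eq_mul] at h3
    rw [(b g).repr.map_zero, Finsupp.zero_apply]
    exact (mul_eq_zero.mp h3).resolve_left h2
  obtain ⟨g⟩ : Nonempty t := by
    by_contra! h
    rw [Set.isEmpty_coe_sort.mp h, Ideal.span_empty] at ht
    exact bot_ne_top ht
  let e := Module.Free.chooseBasis R M
  let e' := (e.ofIsLocalizedModule (Rₚ g) (Submonoid.powers g.val) (f g)).indexEquiv (b g)
  exact ⟨e.reindex e'⟩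

/-- A basis with one element, from a generator with trivial annihilator. -/
def basisOfBijective {R M : Type*} [Semiring R] [AddCommMonoid M] [Module R M] (s : M)
    (h : Function.Bijective fun r : R => r • s) : Module.Basis PUnit.{1} R M :=
  .ofRepr ((LinearEquiv.ofBijective (LinearMap.toSpanSingleton R M s) h).symm.trans
    (Finsupp.uniqueLinearEquiv R R PUnit.unit).symm)

lemma basisOfBijective_apply {R M : Type*} [Semiring R] [AddCommMonoid M] [Module R M] (s : M)
    (h : Function.Bijective fun r : R => r • s) (i : PUnit.{1}) : basisOfBijective s h i = s := by
  change LinearMap.toSpanSingleton R M s (Finsupp.single i 1 PUnit.unit) = s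
  simp

section

open Scheme.Modules

variable {X : Scheme.{u}} {R : CommRingCat.{u}}

/-- The sections of `M` over `V` are generated by one section that is not killed by any nonzero
function. -/
def HasGenerator (M : X.Modules) (V : X.Opens) : Prop :=
  ∃ s : Γ(M, V), Function.Bijective fun g : Γ(X, V) => g • s

lemma IsLineBundle.exists_generator {L : X.Modules} (hL : IsLineBundle L) (x : X) :
    ∃ U : X.Opens, x ∈ U ∧ ∀ V ≤ U, HasGenerator L V := by
  obtain ⟨U, hxU, ⟨α⟩⟩ := hL x
  refine ⟨U, hxU, fun V hV => ?_⟩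
  have hVU : U.ι ''ᵁ U.ι ⁻¹ᵁ V = V := by
    rw [Scheme.Hom.image_preimage_eq_opensRange_inf]
    simpa using hV
  rw [← hVU]
  generalize U.ι ⁻¹ᵁ V = W
  have hα : α.hom ≫ α.inv = 𝟙 _ := α.hom_inv_id
  have hα' : α.inv ≫ α.hom = 𝟙 _ := α.inv_hom_id
  let φ (y : Γ(L, U.ι ''ᵁ W)) : Γ((U : Scheme.{u}), W) := α.hom.app W y
  let ψ (y : Γ((U : Scheme.{u}), W)) : Γ(L, U.ι ''ᵁ W) := α.inv.app W y
  have hφψ (y) : φ (ψ y) = y := congr(($hα').app W y)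
  have hψφ (y) : ψ (φ y) = y := congr(($hα).app W y)
  have hψ (r y : Γ((U : Scheme.{u}), W)) : ψ (r * y) = (U.ι.appIso W).inv r • ψ y :=
    α.inv.app_smul r y
  have hb : Function.Bijective ψ := Function.bijective_iff_has_inverse.mpr ⟨φ, hφψ, hψφ⟩
  refine ⟨ψ 1, ?_⟩
  have h2 : (fun g : Γ(X, U.ι ''ᵁ W) => g • ψ 1) = ψ ∘ (U.ι.appIso W).hom := by
    funext g
    have h3 := hψ ((U.ι.appIso W).hom g) 1
    rw [mul_one] at h3
    refine Eq.trans ?_ h3.symm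
    congr 1
    exact congr($((U.ι.appIso W).hom_inv_id) g).symm
  rw [h2]
  exact hb.comp (ConcreteCategory.bijective_of_isIso (U.ι.appIso W).hom)

lemma IsLineBundle.exists_basicOpen_generator {L : X.Modules} (hL : IsLineBundle L)
    (f : Spec R ⟶ X) [IsOpenImmersion f] (x : Spec R) :
    ∃ r : R, x ∈ PrimeSpectrum.basicOpen r ∧
      HasGenerator (L.restrict f) (PrimeSpectrum.basicOpen r) := by
  obtain ⟨U, hxU, hU⟩ := hL.exists_generator (f x)
  obtain ⟨_, ⟨r, rfl⟩, hxr, hr⟩ :=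
    PrimeSpectrum.isTopologicalBasis_basic_opens.exists_subset_of_mem_open
    (show x ∈ (f ⁻¹ᵁ U : Set (Spec R)) from hxU) (f ⁻¹ᵁ U).isOpen
  refine ⟨r, hxr, ?_⟩
  obtain ⟨s, hs⟩ := hU (f ''ᵁ (PrimeSpectrum.basicOpen r)) (by
    rintro _ ⟨y, hy, rfl⟩
    exact hr hy)
  exact ⟨s, hs.comp (ConcreteCategory.bijective_of_isIso (f.appIso _).inv)⟩

/-- Line bundles are trivial on the spectrum of a principal ideal domain. -/
lemma IsLineBundle.nonempty_basis {L : X.Modules} (hL : IsLineBundle L)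
    [SheafOfModules.IsQuasicoherent.{u} (R := X.ringCatSheaf) L] [IsDomain R]
    [IsPrincipalIdealRing R] (f : Spec R ⟶ X) [IsOpenImmersion f] :
    Nonempty (Module.Basis PUnit.{1} R ((chartSections f).obj L)) := by
  let t : Set R := {r | r ≠ 0 ∧ HasGenerator (L.restrict f) (PrimeSpectrum.basicOpen r)}
  have ht : Ideal.span t = ⊤ := by
    by_contra h
    obtain ⟨m, hm, hle⟩ := Ideal.exists_le_maximal _ h
    obtain ⟨r, hr, hs⟩ := hL.exists_basicOpen_generator f ⟨m, hm.isPrime⟩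
    refine hr (hle (Ideal.subset_span ⟨?_, hs⟩))
    rintro rfl
    exact hr (zero_mem m)
  have hmod (r : R) (U : (Spec R).Opens) (hU : U = PrimeSpectrum.basicOpen r) :
      IsLocalizedModule.Away r
        ((modulesSpecToSheaf.obj (L.restrict f)).obj.map U.leTop.op).hom := by
    subst hU
    exact isLocalizedModule_restrict f L r
  have hring (r : R) (U : (Spec R).Opens) (hU : U = PrimeSpectrum.basicOpen r) :
      IsLocalization.Away r Γ(Spec R, U) := by
    subst hU
    infer_instance
  -- The open subsets are kept abstract, so that the special instances for sections over basic open
  -- subsets do not interfere.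
  obtain ⟨D, hD⟩ : ∃ D : t → (Spec R).Opens, ∀ g, D g = PrimeSpectrum.basicOpen g.val :=
    ⟨_, fun _ => rfl⟩
  have hgen (g : t) : HasGenerator (L.restrict f) (D g) := by
    rw [hD]
    exact g.2.2
  let F (g : t) : Γ(L.restrict f, ⊤) →ₗ[R] Γ(L.restrict f, D g) :=
    ((modulesSpecToSheaf.obj (L.restrict f)).obj.map (D g).leTop.op).hom
  have hF (g : t) : IsLocalizedModule.Away g.val (F g) := hmod g.val (D g) (hD g)
  have hR (g : t) : IsLocalization.Away g.val Γ(Spec R, D g) := hring g.val (D g) (hD g)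
  exact nonempty_basis_of_localization_span (M := Γ(L.restrict f, ⊤)) t ht (fun g => g.2.1)
    (Rₚ := fun g => Γ(Spec R, D g)) (Mₚ := fun g => Γ(L.restrict f, D g)) F (hf := hF)
    fun g => ⟨basisOfBijective (hgen g).choose (hgen g).choose_spec⟩

end

/-! ### Monomial bases of line bundles -/

section Units

open LaurentPolynomial

/-- The units of the ring of Laurent polynomials over a field are the monomials. -/
lemma LaurentPolynomial.exists_eq_C_mul_T_of_mul_eq_one {k : Type*} [Field k] {p q : k[T;T⁻¹]}
    (h : p * q = 1) : ∃ (r : k) (n : ℤ), r ≠ 0 ∧ p = C r * T n := by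
  obtain ⟨a, f, hf⟩ := p.exists_T_pow
  obtain ⟨b, g, hg⟩ := q.exists_T_pow
  have hfg : f * g = Polynomial.X ^ (a + b) := by
    apply Polynomial.toLaurent_injective
    rw [map_mul, hf, hg, Polynomial.toLaurent_X_pow, mul_mul_mul_comm, h, one_mul, ← T_add]
    push_cast
    rfl
  obtain ⟨i, -, u, hu⟩ := (dvd_prime_pow Polynomial.prime_X _).mp (Dvd.intro _ hfg)
  obtain ⟨s, hs, hs'⟩ := Polynomial.isUnit_iff.mp u⁻¹.isUnit
  have hfi : f = Polynomial.C s * Polynomial.X ^ i := by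
    rw [hs', ← hu, mul_comm f, Units.inv_mul_cancel_left]
  refine ⟨s, i - a, hs.ne_zero, ?_⟩
  rw [T_sub, ← mul_assoc, ← Polynomial.toLaurent_C_mul_X_pow, ← hfi, hf, mul_T_assoc,
    add_neg_cancel, T_zero, mul_one]

end Units

/-- The image of a generator under a semilinear map that behaves like a localization is again a
generator. -/
lemma bijective_smul_of_semilinear {R S A B : Type*} [CommRing R] [IsDomain R] [CommRing S]
    {σ : R →+* S} [AddCommGroup A] [AddCommGroup B] [Module R A] [Module S B] (ρ : A →ₛₗ[σ] B)
    (e : Module.Basis PUnit.{1} R A) (x : R) (hx : x ≠ 0) (hu : IsUnit (σ x))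
    (hS : ∀ p, ∃ (n : ℕ) (r : R), σ r = σ x ^ n * p)
    (hsurj : ∀ y, ∃ (n : ℕ) (z : A), ρ z = σ x ^ n • y)
    (hinj : ∀ z, ρ z = 0 → ∃ n : ℕ, x ^ n • z = 0) :
    Function.Bijective fun p : S => p • ρ (e PUnit.unit) := by
  have he (z : A) : z = e.repr z PUnit.unit • e PUnit.unit := by
    conv_lhs => rw [← e.sum_repr z]
    simp
  constructor
  · refine (injective_iff_map_eq_zero (LinearMap.toSpanSingleton S B (ρ (e PUnit.unit)))).mpr
      fun p hp => ?_
    obtain ⟨n, r, hr⟩ := hS p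
    obtain ⟨m, hm⟩ := hinj (r • e PUnit.unit) (by
      rw [map_smulₛₗ, hr, mul_smul]
      exact (congrArg (σ x ^ n • ·) hp).trans (smul_zero _))
    have h1 : x ^ m * r = 0 := by
      simpa using congr(e.repr $hm PUnit.unit)
    have h2 : r = 0 := (mul_eq_zero.mp h1).resolve_left (pow_ne_zero _ hx)
    rw [h2, map_zero] at hr
    exact ((hu.pow n).mul_right_eq_zero.mp hr.symm)
  · intro y
    obtain ⟨n, z, hz⟩ := hsurj y
    obtain ⟨w, hw⟩ := hu.pow n
    refine ⟨↑w⁻¹ * σ (e.repr z PUnit.unit), ?_⟩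
    simp only
    rw [mul_smul, ← map_smulₛₗ, ← he, hz, ← hw, smul_smul, Units.inv_mul, one_smul]

/-- A coproduct of copies of a free module of rank one is free, on the images of the generator. -/
lemma ModuleCat.exists_basis_of_isColimit {R : Type u} [CommRing R] {I : Type u}
    {Z P : ModuleCat.{u} R} (m : I → (Z ⟶ P)) (h : IsColimit (Cofan.mk P m))
    (e : Module.Basis PUnit.{1} R Z) :
    ∃ b : Module.Basis I R P, ∀ i, b i = m i (e PUnit.unit) := by
  let D : P ⟶ ModuleCat.of R (I →₀ R) := Cofan.IsColimit.desc h
    (fun i => ModuleCat.ofHom (e.constr R fun _ => Finsupp.single i 1))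
  have hD (i : I) : D (m i (e PUnit.unit)) = Finsupp.single i 1 := by
    have h1 : m i ≫ D = _ := Cofan.IsColimit.fac h _ i
    exact congr($h1 (e PUnit.unit)).trans (e.constr_basis R _ _)
  let G : (I →₀ R) →ₗ[R] P := Finsupp.linearCombination R fun i => m i (e PUnit.unit)
  have hG (i : I) : G (Finsupp.single i 1) = m i (e PUnit.unit) := by simp [G]
  have h1 : D.hom ∘ₗ G = LinearMap.id := by
    ext i : 2
    exact (congrArg D (hG i)).trans (hD i)
  have h2 : D ≫ ModuleCat.ofHom G = 𝟙 P := by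
    refine Cofan.IsColimit.hom_ext h _ _ fun i => ?_
    ext1
    refine e.ext fun _ => ?_
    exact (congrArg G (hD i)).trans (hG i)
  refine ⟨.ofRepr (LinearEquiv.ofLinearMap D.hom G h1 congr(($h2).hom)), fun i => ?_⟩
  exact hG i

namespace TwoCharts

open Scheme.Modules LaurentPolynomial

variable {k : Type u} [Field k] {X : Scheme.{u}}
  {c : TwoCharts X (.of (Polynomial k)) (.of (Polynomial k)) (.of k[T;T⁻¹])} (hc : c.IsStandard)

include hc

/-- A line bundle is free of rank one over both charts, and the ratio of the two generators on the
intersection is a unit `r T ^ n`; the constant `r` can be absorbed in a generator. -/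
lemma exists_monomialBases (L : X.Modules) (hL : IsLineBundle L)
    [SheafOfModules.IsQuasicoherent.{u} (R := X.ringCatSheaf) L] :
    ∃ n, Nonempty (MonomialBases c L PUnit.{1} n) := by
  have : IsDomain (CommRingCat.of (Polynomial k)) := inferInstanceAs (IsDomain (Polynomial k))
  have : IsPrincipalIdealRing (CommRingCat.of (Polynomial k)) :=
    inferInstanceAs (IsPrincipalIdealRing (Polynomial k))
  obtain ⟨e₀⟩ := hL.nonempty_basis c.j₀
  obtain ⟨e₁⟩ := hL.nonempty_basis c.j₁
  have hX : (Polynomial.X : Polynomial k) ≠ 0 := Polynomial.X_ne_zero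
  have b₀ := bijective_smul_of_semilinear (c.res₀ L) e₀ c.t (hc.t_eq ▸ hX) c.isUnit_a
    (fun p => by
      obtain ⟨n, f, hf⟩ := LaurentPolynomial.exists_T_pow (R := k) p
      refine ⟨n, f, (hc.a_apply f).trans (hf.trans ?_)⟩
      rw [hc.t_eq, hc.a_apply, Polynomial.toLaurent_X, T_pow, mul_one]
      exact mul_comm _ _)
    (exists_chartRes_eq_pow_smul c.comp₀ c.image₀ L rfl)
    (exists_pow_smul_eq_zero c.comp₀ c.image₀ L rfl)
  have b₁ := bijective_smul_of_semilinear (c.res₁ L) e₁ c.s (hc.s_eq ▸ hX) c.isUnit_b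
    (fun p => by
      obtain ⟨n, f, hf⟩ := LaurentPolynomial.exists_T_pow (invert (R := k) p)
      refine ⟨n, f, (hc.b_apply f).trans ?_⟩
      rw [hc.s_eq, hc.b_apply, Polynomial.toLaurent_X, hf, map_mul, invert_T, invert_T, T_pow,
        mul_neg, mul_one, mul_comm]
      exact congrArg _ (involutive_invert p))
    (exists_chartRes_eq_pow_smul c.comp₁ c.image₁ L rfl)
    (exists_pow_smul_eq_zero c.comp₁ c.image₁ L rfl)
  obtain ⟨p, hp⟩ := b₁.2 (c.res₀ L (e₀ PUnit.unit))
  obtain ⟨q, hq⟩ := b₀.2 (c.res₁ L (e₁ PUnit.unit))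
  have hpq : p * q = 1 := b₁.1 (by
    simp only at hp hq ⊢
    rw [mul_comm, mul_smul, hp, hq, one_smul])
  obtain ⟨r, n, hr, rfl⟩ := exists_eq_C_mul_T_of_mul_eq_one (k := k) hpq
  let w : PUnit.{1} → (Polynomial k)ˣ := fun _ =>
    Units.map Polynomial.C.toMonoidHom (Units.mk0 r hr)
  refine ⟨n, ⟨{
    e₀ := e₀
    e₁ := e₁.unitsSMul w
    e₀₁ := basisOfBijective _ b₀
    res₀_e₀ := fun i => (basisOfBijective_apply _ b₀ i).symm
    res₁_e₁ := fun i => ?_ }⟩⟩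
  refine Eq.trans ?_ (hp.trans (basisOfBijective_apply _ b₀ i).symm)
  rw [Module.Basis.unitsSMul_apply]
  refine (congrArg ((T n : k[T;T⁻¹]) • ·) (res₁_C_smul hc r (e₁ PUnit.unit))).trans ?_
  simp only
  rw [smul_smul, mul_comm]

omit hc in
/-- A coproduct of copies of a module with a monomial generator has monomial bases. -/
lemma nonempty_monomialBases_coproduct (L : QCoh X) {n : ℤ}
    (B : MonomialBases c L.obj PUnit.{1} n) (I : Type u) [HasCoproduct fun _ : I => L] :
    Nonempty (MonomialBases c (∐ fun _ : I => L).obj I n) := by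
  have key {R : CommRingCat.{u}} (f : Spec R ⟶ X) [IsOpenImmersion f]
      (e : Module.Basis PUnit.{1} R ((chartSections f).obj L.obj)) :
      ∃ b : Module.Basis I R ((chartSections f).obj (∐ fun _ : I => L).obj),
        ∀ i, b i = (chartSections f).map (Sigma.ι (fun _ : I => L) i).hom (e PUnit.unit) := by
    have := c.preservesColimitsOfShape_chartSections f (Discrete I)
    exact ModuleCat.exists_basis_of_isColimit _ (isColimitOfHasCoproductOfPreservesColimit
      ((qcohProperty X).ι ⋙ chartSections f) fun _ : I => L) e
  obtain ⟨b₀, hb₀⟩ := key c.j₀ B.e₀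
  obtain ⟨b₁, hb₁⟩ := key c.j₁ B.e₁
  obtain ⟨b, hb⟩ := key c.j₀₁ B.e₀₁
  refine ⟨{ e₀ := b₀
            e₁ := b₁
            e₀₁ := b
            res₀_e₀ := fun i => ?_
            res₁_e₁ := fun i => ?_ }⟩
  · rw [hb₀, hb, c.res₀_map, B.res₀_e₀]
  · rw [hb₁, hb, c.res₁_map, ← B.res₁_e₁]
    exact ((c.sec₀₁.map _).hom.map_smul _ _).symm

/-- Line bundles on a projective line are Σ-c-pure-injective. -/
theorem isSigmaCPureInjective_of_isLineBundle (L : QCoh X) (hL : IsLineBundle L.obj) :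
    IsSigmaCPureInjective L := by
  intro I
  have := c.hasColimitsOfShape_QCoh (Discrete I)
  have := L.property
  obtain ⟨n, ⟨B⟩⟩ := exists_monomialBases hc L.obj hL
  obtain ⟨B'⟩ := nonempty_monomialBases_coproduct L B I
  exact ⟨inferInstance, c.isCPureInjective_of_exists_extension _ fun E hE φ =>
    B'.exists_extension hc hE φ⟩

end TwoCharts

/-! ### Evaluation of homogeneous fractions -/

section AwayEval

attribute [local instance] MvPolynomial.gradedAlgebra

open MvPolynomial HomogeneousLocalization

variable {σ k B B' : Type*} [CommRing k] [CommRing B] [CommRing B'] [Algebra k B]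
  [Algebra k B']

lemma MvPolynomial.aeval_mul_of_isHomogeneous {p : MvPolynomial σ k} {d : ℕ}
    (hp : p.IsHomogeneous d) (s : B) (w : σ → B) :
    aeval (fun i => s * w i) p = s ^ d * aeval w p := by
  rw [aeval_def, aeval_def, eval₂_eq, eval₂_eq, Finset.mul_sum]
  refine Finset.sum_congr rfl fun m hm => ?_
  have hd : ∑ i ∈ m.support, m i = d := by
    rw [← hp (mem_support_iff.mp hm), Finsupp.weight_apply, Finsupp.sum]
    simp
  simp only [mul_pow, Finset.prod_mul_distrib, Finset.prod_pow_eq_pow_sum, hd]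
  ring

lemma MvPolynomial.aeval_comp_apply (g : B →ₐ[k] B') (w : σ → B) (p : MvPolynomial σ k) :
    aeval (fun i => g (w i)) p = g (aeval w p) := by
  have h : aeval (fun i => g (w i)) = g.comp (aeval (R := k) w) := by
    ext i
    simp
  rw [h, AlgHom.comp_apply]

/-- The value at a point `w` of a homogeneous fraction of degree zero whose denominator is a power
of `f`, where `f` is invertible at `w`. -/
def awayEval (f : MvPolynomial σ k) (w : σ → B) (hw : IsUnit (aeval w f)) :
    Away (homogeneousSubmodule σ k) f →+* B :=
  (IsLocalization.Away.lift (S := Localization.Away f) f (g := (aeval w).toRingHom) hw).comp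
    (algebraMap _ _)

variable {f : MvPolynomial σ k} {w : σ → B} (hw : IsUnit (aeval w f))

lemma awayEval_apply_mk_mul {d : ℕ} (hf : f ∈ homogeneousSubmodule σ k d) (n : ℕ)
    (p : MvPolynomial σ k) (hp : p ∈ homogeneousSubmodule σ k (n • d)) :
    awayEval f w hw (Away.mk _ hf n p hp) * aeval w f ^ n = aeval w p := by
  have h1 : (Away.mk (homogeneousSubmodule σ k) hf n p hp).val *
      algebraMap _ (Localization.Away f) f ^ n = algebraMap _ _ p := by
    rw [Away.val_mk, Localization.mk_eq_mk', ← map_pow]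
    exact IsLocalization.mk'_spec _ _ (⟨f ^ n, n, rfl⟩ : Submonoid.powers f)
  have h2 := congrArg (IsLocalization.Away.lift (S := Localization.Away f) f
    (g := (aeval w).toRingHom) hw) h1
  rw [map_mul, map_pow, IsLocalization.Away.lift_eq, IsLocalization.Away.lift_eq] at h2
  exact h2

lemma awayEval_ext {d : ℕ} (hf : f ∈ homogeneousSubmodule σ k d)
    (φ : Away (homogeneousSubmodule σ k) f →+* B)
    (h : ∀ n p hp, φ (Away.mk _ hf n p hp) * aeval w f ^ n = aeval w p) :
    φ = awayEval f w hw := by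
  ext z
  obtain ⟨n, p, hp, rfl⟩ := Away.mk_surjective _ hf z
  exact (hw.pow n).mul_left_injective
    ((h n p hp).trans (awayEval_apply_mk_mul hw hf n p hp).symm)

lemma comp_awayEval {d : ℕ} (hf : f ∈ homogeneousSubmodule σ k d) (g : B →ₐ[k] B')
    (w' : σ → B') (hw' : IsUnit (aeval w' f)) (h : ∀ i, g (w i) = w' i) :
    g.toRingHom.comp (awayEval f w hw) = awayEval f w' hw' := by
  have hg (p : MvPolynomial σ k) : aeval w' p = g (aeval w p) := by
    rw [← aeval_comp_apply, funext h]
  refine awayEval_ext hw' hf _ fun n p hp => ?_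
  rw [hg, hg, ← awayEval_apply_mk_mul hw hf n p hp, map_mul, map_pow]
  rfl

/-- Homogeneous fractions of degree zero take the same value at proportional points. -/
lemma awayEval_eq_of_mul {d : ℕ} (hf : f ∈ homogeneousSubmodule σ k d) (w' : σ → B)
    (hw' : IsUnit (aeval w' f)) (s : B) (h : ∀ i, s * w i = w' i) :
    awayEval f w hw = awayEval f w' hw' := by
  obtain rfl : (fun i => s * w i) = w' := funext h
  refine awayEval_ext hw' hf _ fun n p hp => ?_
  rw [aeval_mul_of_isHomogeneous hf, aeval_mul_of_isHomogeneous hp, ← awayEval_apply_mk_mul hw hf n p hp]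
  simp only [smul_eq_mul]
  ring

lemma awayEval_comp_awayMap {d e : ℕ} (hf : f ∈ homogeneousSubmodule σ k d) {g x : MvPolynomial σ k}
    (hg : g ∈ homogeneousSubmodule σ k e) (hx : x = f * g) (hw' : IsUnit (aeval w x)) :
    (awayEval x w hw').comp (awayMap _ hg hx) = awayEval f w hw := by
  refine awayEval_ext hw hf _ fun n p hp => ?_
  have h1 := awayEval_apply_mk_mul hw' (d := d + e) (hx ▸ SetLike.mul_mem_graded hf hg) n (p * g ^ n)
    (by
      rw [smul_add]
      exact SetLike.mul_mem_graded hp (SetLike.pow_mem_graded n hg))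
  rw [RingHom.comp_apply, awayMap_mk]
  have hgu : IsUnit (aeval w g) := by
    rw [hx, map_mul] at hw'
    exact isUnit_of_mul_isUnit_right hw'
  refine (hgu.pow n).mul_left_injective ?_
  simp only
  rw [map_mul, map_pow] at h1
  have h2 : aeval w x = aeval w f * aeval w g := by rw [hx, map_mul]
  refine Eq.trans ?_ h1
  rw [h2, mul_comm (aeval w f), mul_pow]
  ring

lemma awayEval_surjective {d : ℕ} (hf : f ∈ homogeneousSubmodule σ k d) (G : Set B)
    (hG : Algebra.adjoin k G = ⊤)
    (h : ∀ b ∈ G, ∃ (n : ℕ) (p : MvPolynomial σ k), p ∈ homogeneousSubmodule σ k (n • d) ∧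
      b * aeval w f ^ n = aeval w p) :
    Function.Surjective (awayEval f w hw) := by
  have key (b : B) (n : ℕ) (p : MvPolynomial σ k) (hp : p ∈ homogeneousSubmodule σ k (n • d))
      (hb : b * aeval w f ^ n = aeval w p) : b ∈ (awayEval f w hw).range :=
    ⟨Away.mk _ hf n p hp,
      (hw.pow n).mul_left_injective ((awayEval_apply_mk_mul hw hf n p hp).trans hb.symm)⟩
  let S : Subalgebra k B :=
    { (awayEval f w hw).range with
      algebraMap_mem' := fun r => key _ 0 (C r) (by
        rw [zero_smul]
        exact isHomogeneous_C _ _) (by simp) }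
  have hS : S = ⊤ := by
    rw [eq_top_iff, ← hG]
    refine Algebra.adjoin_le fun b hb => ?_
    obtain ⟨n, p, hp, hbp⟩ := h b hb
    exact key b n p hp hbp
  intro b
  have : b ∈ S := hS ▸ Algebra.mem_top
  exact this

/-- Evaluation of fractions at `w` is bijective if, over the ring of all fractions, the point `w` is
proportional to the tautological one, and the values of fractions generate. -/
lemma awayEval_bijective {d : ℕ} (hf : f ∈ homogeneousSubmodule σ k d)
    (θ : B →ₐ[k] Localization.Away f) (s : Localization.Away f)
    (h : ∀ i, s * θ (w i) = algebraMap _ _ (X i : MvPolynomial σ k))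
    (hsurj : Function.Surjective (awayEval f w hw)) :
    Function.Bijective (awayEval f w hw) := by
  have hX (p : MvPolynomial σ k) : aeval (fun i => algebraMap (MvPolynomial σ k)
      (Localization.Away f) (X i)) p = algebraMap _ _ p := by
    have : (aeval fun i => algebraMap (MvPolynomial σ k) (Localization.Away f) (X i)) =
        IsScalarTower.toAlgHom k (MvPolynomial σ k) (Localization.Away f) := by
      ext i
      simp
    rw [this]
    rfl
  have hu : IsUnit (aeval (fun i => algebraMap (MvPolynomial σ k) (Localization.Away f) (X i)) f) := by
    rw [hX]
    exact IsLocalization.Away.algebraMap_isUnit f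
  have hu' : IsUnit (aeval (fun i => θ (w i)) f) := by
    rw [aeval_comp_apply]
    exact hw.map θ
  have h1 : θ.toRingHom.comp (awayEval f w hw) = algebraMap _ _ := by
    rw [comp_awayEval hw hf θ _ hu' fun _ => rfl, awayEval_eq_of_mul hu' hf _ hu s h]
    symm
    refine awayEval_ext hu hf _ fun n p hp => ?_
    rw [hX, hX, HomogeneousLocalization.algebraMap_apply, Away.val_mk, Localization.mk_eq_mk', ← map_pow]
    exact IsLocalization.mk'_spec _ _ (⟨f ^ n, n, rfl⟩ : Submonoid.powers f)
  refine ⟨fun x y hxy => val_injective _ ?_, hsurj⟩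
  have h2 := congrArg θ.toRingHom hxy
  rw [← RingHom.comp_apply, ← RingHom.comp_apply, h1] at h2
  exact h2

end AwayEval

/-! ### The standard charts of the projective line -/

section StandardCharts

attribute [local instance] MvPolynomial.gradedAlgebra

open MvPolynomial HomogeneousLocalization LaurentPolynomial

variable (k : Type u) [Field k]

lemma MvPolynomial.X_mem_homogeneousSubmodule {σ R : Type*} [CommSemiring R] (i : σ) :
    (X i : MvPolynomial σ R) ∈ homogeneousSubmodule σ R 1 :=
  isHomogeneous_X _ _

lemma MvPolynomial.X_mul_X_mem_homogeneousSubmodule {σ R : Type*} [CommSemiring R] (i j : σ) :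
    (X i * X j : MvPolynomial σ R) ∈ homogeneousSubmodule σ R 2 :=
  (isHomogeneous_X R i).mul (isHomogeneous_X R j)

lemma isUnit_aeval_X_zero :
    IsUnit (aeval ![(1 : Polynomial k), Polynomial.X] (X 0 : MvPolynomial (Fin 2) k)) := by
  simp

lemma isUnit_aeval_X_one :
    IsUnit (aeval ![Polynomial.X, (1 : Polynomial k)] (X 1 : MvPolynomial (Fin 2) k)) := by
  simp

lemma isUnit_aeval_X_zero_mul_X_one :
    IsUnit (aeval ![(1 : k[T;T⁻¹]), T 1] (X 0 * X 1 : MvPolynomial (Fin 2) k)) := by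
  simpa using isUnit_T 1

lemma LaurentPolynomial.adjoin_T_eq_top {R : Type*} [CommRing R] :
    Algebra.adjoin R {(T 1 : R[T;T⁻¹]), T (-1)} = ⊤ := by
  refine eq_top_iff.mpr fun p _ => ?_
  have hT (n : ℤ) : (T n : R[T;T⁻¹]) ∈ Algebra.adjoin R {(T 1 : R[T;T⁻¹]), T (-1)} := by
    obtain ⟨m, rfl | rfl⟩ := n.eq_nat_or_neg
    · have := pow_mem (Algebra.subset_adjoin (R := R) (Set.mem_insert (T 1 : R[T;T⁻¹]) {T (-1)})) m
      simpa [T_pow] using this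
    · have := pow_mem (Algebra.subset_adjoin (R := R)
        (Set.mem_insert_of_mem (T 1 : R[T;T⁻¹]) (Set.mem_singleton (T (-1))))) m
      simpa [T_pow] using this
  induction p using LaurentPolynomial.induction_on' with
  | add p q hp hq => exact add_mem (hp trivial) (hq trivial)
  | C_mul_T n a =>
    rw [← smul_eq_C_mul]
    exact Subalgebra.smul_mem _ (hT n) a

/-- The evaluation of fractions with denominator a power of `x₀` at the point `(1 : X)`. -/
abbrev evalX₀ : Away (homogeneousSubmodule (Fin 2) k) (X 0) →+* Polynomial k :=
  awayEval _ _ (isUnit_aeval_X_zero k)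

/-- The evaluation of fractions with denominator a power of `x₁` at the point `(X : 1)`. -/
abbrev evalX₁ : Away (homogeneousSubmodule (Fin 2) k) (X 1) →+* Polynomial k :=
  awayEval _ _ (isUnit_aeval_X_one k)

/-- The evaluation of fractions with denominator a power of `x₀ x₁` at the point `(1 : T)`. -/
abbrev evalX₀X₁ : Away (homogeneousSubmodule (Fin 2) k) (X 0 * X 1) →+* k[T;T⁻¹] :=
  awayEval _ _ (isUnit_aeval_X_zero_mul_X_one k)

/-- The fraction `x₁ / x₀` identifies the first chart of the projective line with the affine
line. -/
lemma bijective_evalX₀ : Function.Bijective (evalX₀ k) := by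
  let x₀ : Localization.Away (X 0 : MvPolynomial (Fin 2) k) := algebraMap (MvPolynomial (Fin 2) k) _ (X 0)
  have hx₀ : IsUnit x₀ := IsLocalization.Away.algebraMap_isUnit _
  refine awayEval_bijective _ (X_mem_homogeneousSubmodule 0)
    (Polynomial.aeval (hx₀.unit⁻¹.val * algebraMap _ _ (X 1 : MvPolynomial (Fin 2) k))) x₀ ?_ ?_
  · intro i
    fin_cases i
    · simp [x₀]
    · simp only [Fin.mk_one, Matrix.cons_val_one, Matrix.cons_val_fin_one, Polynomial.aeval_X]
      rw [← mul_assoc, hx₀.mul_val_inv, one_mul]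
  · refine awayEval_surjective _ (X_mem_homogeneousSubmodule 0) {Polynomial.X}
      Polynomial.adjoin_X ?_
    rintro _ rfl
    exact ⟨1, X 1, X_mem_homogeneousSubmodule 1, by simp⟩

/-- The fraction `x₀ / x₁` identifies the second chart of the projective line with the affine
line. -/
lemma bijective_evalX₁ : Function.Bijective (evalX₁ k) := by
  let x₁ : Localization.Away (X 1 : MvPolynomial (Fin 2) k) := algebraMap (MvPolynomial (Fin 2) k) _ (X 1)
  have hx₁ : IsUnit x₁ := IsLocalization.Away.algebraMap_isUnit _
  refine awayEval_bijective _ (X_mem_homogeneousSubmodule 1)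
    (Polynomial.aeval (hx₁.unit⁻¹.val * algebraMap _ _ (X 0 : MvPolynomial (Fin 2) k))) x₁ ?_ ?_
  · intro i
    fin_cases i
    · simp only [Fin.zero_eta, Matrix.cons_val_zero, Polynomial.aeval_X]
      rw [← mul_assoc, hx₁.mul_val_inv, one_mul]
    · simp [x₁]
  · refine awayEval_surjective _ (X_mem_homogeneousSubmodule 1) {Polynomial.X}
      Polynomial.adjoin_X ?_
    rintro _ rfl
    exact ⟨1, X 0, X_mem_homogeneousSubmodule 0, by simp⟩

/-- The fraction `x₁ / x₀` identifies the intersection of the two charts with the punctured affine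
line. -/
lemma bijective_evalX₀X₁ :
    Function.Bijective (evalX₀X₁ k) := by
  let A := Localization.Away (X 0 * X 1 : MvPolynomial (Fin 2) k)
  let x₀ : A := algebraMap (MvPolynomial (Fin 2) k) _ (X 0)
  let x₁ : A := algebraMap (MvPolynomial (Fin 2) k) _ (X 1)
  have hx : IsUnit (x₀ * x₁) := by
    have : IsUnit (algebraMap (MvPolynomial (Fin 2) k) A (X 0 * X 1)) :=
      IsLocalization.Away.algebraMap_isUnit _
    rwa [map_mul] at this
  have hx₀ : IsUnit x₀ := isUnit_of_mul_isUnit_left hx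
  have hx₁ : IsUnit x₁ := isUnit_of_mul_isUnit_right hx
  let θ : k[T;T⁻¹] →ₐ[k] A :=
    { LaurentPolynomial.eval₂ (algebraMap k A) (hx₀.unit⁻¹ * hx₁.unit) with
      commutes' := fun r => eval₂_C _ _ r }
  refine awayEval_bijective _ (X_mul_X_mem_homogeneousSubmodule 0 1) θ x₀ ?_ ?_
  · intro i
    fin_cases i
    · exact (congrArg (x₀ * ·) (map_one θ)).trans (mul_one _)
    · have hθ : θ (T 1) = hx₀.unit⁻¹.val * x₁ := (eval₂_T _ _ 1).trans (by simp)
      simp only [Fin.mk_one, Matrix.cons_val_one, Matrix.cons_val_fin_one, hθ]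
      rw [← mul_assoc, hx₀.mul_val_inv, one_mul]
  · refine awayEval_surjective _ (X_mul_X_mem_homogeneousSubmodule 0 1) _
      adjoin_T_eq_top ?_
    rintro _ (rfl | rfl)
    · exact ⟨1, X 1 * X 1, X_mul_X_mem_homogeneousSubmodule 1 1, by
        simp only [pow_one, map_mul, aeval_X, Matrix.cons_val_zero, Matrix.cons_val_one,
        Matrix.cons_val_fin_one, one_mul]⟩
    · exact ⟨1, X 0 * X 0, X_mul_X_mem_homogeneousSubmodule 0 0, by
        simp only [pow_one, map_mul, aeval_X, Matrix.cons_val_zero, Matrix.cons_val_one,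
        Matrix.cons_val_fin_one, one_mul]
        exact (T_add (-1) 1).symm⟩

lemma toLaurent_comp_evalX₀ :
    (Polynomial.toLaurentAlg (R := k)).toRingHom.comp (evalX₀ k) =
      (evalX₀X₁ k).comp
        (awayMap _ (X_mem_homogeneousSubmodule 1) rfl) := by
  have h : IsUnit (aeval ![(1 : k[T;T⁻¹]), T 1] (X 0 : MvPolynomial (Fin 2) k)) := by simp
  rw [awayEval_comp_awayMap h (X_mem_homogeneousSubmodule 0)]
  refine comp_awayEval _ (X_mem_homogeneousSubmodule 0) _ _ _ fun i => ?_
  fin_cases i <;> simp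

lemma invert_toLaurent_comp_evalX₁ :
    ((invert (R := k)).toAlgHom.comp Polynomial.toLaurentAlg).toRingHom.comp
        (evalX₁ k) =
      (evalX₀X₁ k).comp
        (awayMap _ (X_mem_homogeneousSubmodule 0) (mul_comm _ _)) := by
  have h : IsUnit (aeval ![(1 : k[T;T⁻¹]), T 1] (X 1 : MvPolynomial (Fin 2) k)) := by
    simpa using isUnit_T 1
  have h' : IsUnit (aeval ![(T (-1) : k[T;T⁻¹]), 1] (X 1 : MvPolynomial (Fin 2) k)) := by simp
  rw [awayEval_comp_awayMap h (X_mem_homogeneousSubmodule 1),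
    comp_awayEval _ (X_mem_homogeneousSubmodule 1) _ ![T (-1), 1] h' fun i => ?_]
  · refine awayEval_eq_of_mul h' (X_mem_homogeneousSubmodule 1) _ h (T 1) fun i => ?_
    fin_cases i
    · exact (T_add 1 (-1)).symm
    · exact mul_one _
  · fin_cases i <;> simp

lemma isIso_Spec_map_ofHom {A B : Type u} [CommRing A] [CommRing B] (φ : A →+* B)
    (h : Function.Bijective φ) : IsIso (Spec.map (CommRingCat.ofHom φ)) := by
  have : IsIso (CommRingCat.ofHom φ) := (ConcreteCategory.isIso_iff_bijective _).mpr h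
  infer_instance

/-- If `φ : R ⟶ S` identifies `Spec S` with the principal open subset `r ≠ 0` of `Spec R` as a set,
then a chart on `Spec R` maps this subset onto the image of the induced chart on `Spec S`. -/
lemma image_top_of_range_comap {X : Scheme.{u}} {R S : CommRingCat.{u}} {f : Spec R ⟶ X}
    [IsOpenImmersion f] {φ : R ⟶ S} {f' : Spec S ⟶ X} [IsOpenImmersion f'] (h : Spec.map φ ≫ f = f')
    (r : R) (hr : Set.range (PrimeSpectrum.comap φ.hom) = PrimeSpectrum.basicOpen r) :
    f' ''ᵁ ⊤ = f ''ᵁ (PrimeSpectrum.basicOpen r) := by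
  subst h
  refine TopologicalSpace.Opens.ext ?_
  have h1 : Set.range (Spec.map φ ≫ f) = f '' Set.range (PrimeSpectrum.comap φ.hom) := by
    exact Set.range_comp f (Spec.map φ)
  rw [Scheme.Hom.image_top_eq_opensRange]
  exact h1.trans (congrArg (f '' ·) hr)

lemma range_comap_toLaurent :
    Set.range (PrimeSpectrum.comap (Polynomial.toLaurentAlg (R := k)).toRingHom) =
      PrimeSpectrum.basicOpen (Polynomial.X : Polynomial k) :=
  PrimeSpectrum.localization_away_comap_range k[T;T⁻¹] (Polynomial.X : Polynomial k)

lemma range_comap_invert_toLaurent :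
    Set.range (PrimeSpectrum.comap
      ((invert (R := k)).toAlgHom.comp Polynomial.toLaurentAlg).toRingHom) =
      PrimeSpectrum.basicOpen (Polynomial.X : Polynomial k) := by
  rw [← range_comap_toLaurent]
  have h : Function.Surjective (PrimeSpectrum.comap (invert (R := k)).toAlgHom.toRingHom) :=
    (PrimeSpectrum.comapEquiv (invert (R := k)).toRingEquiv).symm.surjective
  exact h.range_comp (PrimeSpectrum.comap (Polynomial.toLaurentAlg (R := k)).toRingHom)

variable {k}

/-- The inclusion of a standard open subset into `Proj k[x₀, x₁]`, with a given parametrization. -/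
def standardChart {B : Type u} [CommRing B] {f : MvPolynomial (Fin 2) k}
    {d : ℕ} (hf : f ∈ homogeneousSubmodule (Fin 2) k d) (hd : 0 < d)
    (φ : Away (homogeneousSubmodule (Fin 2) k) f →+* B) :
    Spec (.of B) ⟶ Proj (homogeneousSubmodule (Fin 2) k) :=
  Spec.map (CommRingCat.ofHom φ) ≫ Proj.awayι (homogeneousSubmodule (Fin 2) k) f hf hd

lemma isOpenImmersion_standardChart {B : Type u} [CommRing B] {f : MvPolynomial (Fin 2) k}
    {d : ℕ} (hf : f ∈ homogeneousSubmodule (Fin 2) k d) (hd : 0 < d)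
    (φ : Away (homogeneousSubmodule (Fin 2) k) f →+* B) (h : Function.Bijective φ) :
    IsOpenImmersion (standardChart hf hd φ) := by
  have := isIso_Spec_map_ofHom φ h
  unfold standardChart
  infer_instance

lemma standardChart_image_top {B : Type u} [CommRing B] {f : MvPolynomial (Fin 2) k}
    {d : ℕ} (hf : f ∈ homogeneousSubmodule (Fin 2) k d) (hd : 0 < d)
    (φ : Away (homogeneousSubmodule (Fin 2) k) f →+* B) (h : Function.Bijective φ) :
    haveI := isOpenImmersion_standardChart hf hd φ h
    standardChart hf hd φ ''ᵁ ⊤ = Proj.basicOpen _ f := by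
  have := isIso_Spec_map_ofHom φ h
  have := isOpenImmersion_standardChart hf hd φ h
  rw [Scheme.Hom.image_top_eq_opensRange, ← Proj.opensRange_awayι _ f hf hd]
  refine TopologicalSpace.Opens.ext ?_
  exact (Spec.map (CommRingCat.ofHom φ)).surjective.range_comp (Proj.awayι _ f hf hd)

/-- Compatibility of parametrizations of fractions with the localization maps gives compatibility of
the charts. -/
lemma Spec_map_comp_standardChart {B B' : Type u} [CommRing B] [CommRing B']
    {f g x : MvPolynomial (Fin 2) k} {d e : ℕ} (hf : f ∈ homogeneousSubmodule (Fin 2) k d)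
    (hd : 0 < d) (hg : g ∈ homogeneousSubmodule (Fin 2) k e) (hx : x = f * g)
    (hxm : x ∈ homogeneousSubmodule (Fin 2) k (d + e)) (hm : 0 < d + e)
    (φ : Away (homogeneousSubmodule (Fin 2) k) f →+* B)
    (ψ : Away (homogeneousSubmodule (Fin 2) k) x →+* B') (a : B →+* B')
    (h : a.comp φ = ψ.comp (awayMap _ hg hx)) :
    Spec.map (CommRingCat.ofHom a) ≫ standardChart hf hd φ = standardChart hxm hm ψ := by
  unfold standardChart
  rw [← Proj.SpecMap_awayMap_awayι _ hf hd hg hx, ← Category.assoc, ← Category.assoc,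
    ← Spec.map_comp, ← Spec.map_comp, ← CommRingCat.ofHom_comp, ← CommRingCat.ofHom_comp, h]

lemma basicOpen_X_zero_sup_basicOpen_X_one :
    Proj.basicOpen (homogeneousSubmodule (Fin 2) k) (X 0) ⊔
      Proj.basicOpen (homogeneousSubmodule (Fin 2) k) (X 1) = ⊤ := by
  have h := Proj.iSup_basicOpen_eq_top' (homogeneousSubmodule (Fin 2) k)
    (X : Fin 2 → MvPolynomial (Fin 2) k) (fun i => ⟨1, X_mem_homogeneousSubmodule i⟩) (by
      refine eq_top_iff.mpr fun p _ => ?_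
      induction p using MvPolynomial.induction_on with
      | C r => exact Subalgebra.algebraMap_mem _ (⟨C r, isHomogeneous_C _ r⟩ :
          homogeneousSubmodule (Fin 2) k 0)
      | add p q hp hq => exact add_mem (hp trivial) (hq trivial)
      | mul_X p i hp => exact mul_mem (hp trivial) (Algebra.subset_adjoin ⟨i, rfl⟩))
  refine top_le_iff.mp (h.ge.trans (iSup_le fun i => ?_))
  fin_cases i
  · exact le_sup_left
  · exact le_sup_right

/-- The standard charts of the projective line: `x₀ ≠ 0` with coordinate `x₁ / x₀`, and `x₁ ≠ 0` with
coordinate `x₀ / x₁`. On their intersection, `T` stands for `x₁ / x₀`. -/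
def projectiveLineCharts (k : Type u) [Field k] :
    TwoCharts (projectiveLine k) (.of (Polynomial k)) (.of (Polynomial k)) (.of k[T;T⁻¹]) :=
  have h₀ := isOpenImmersion_standardChart (X_mem_homogeneousSubmodule 0) one_pos _
    (bijective_evalX₀ k)
  have h₁ := isOpenImmersion_standardChart (X_mem_homogeneousSubmodule 1) one_pos _
    (bijective_evalX₁ k)
  have h₀₁ := isOpenImmersion_standardChart (X_mul_X_mem_homogeneousSubmodule 0 1) two_pos _
    (bijective_evalX₀X₁ k)
  have comp₀ := Spec_map_comp_standardChart (X_mem_homogeneousSubmodule 0) one_pos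
    (X_mem_homogeneousSubmodule 1) rfl (X_mul_X_mem_homogeneousSubmodule 0 1) two_pos _ _ _
    (toLaurent_comp_evalX₀ k)
  have comp₁ := Spec_map_comp_standardChart (X_mem_homogeneousSubmodule 1) one_pos
    (X_mem_homogeneousSubmodule 0) (mul_comm _ _) (X_mul_X_mem_homogeneousSubmodule 0 1) two_pos
    _ _ _ (invert_toLaurent_comp_evalX₁ k)
  { j₀ := standardChart (X_mem_homogeneousSubmodule 0) one_pos (evalX₀ k)
    j₁ := standardChart (X_mem_homogeneousSubmodule 1) one_pos (evalX₁ k)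
    j₀₁ := standardChart (X_mul_X_mem_homogeneousSubmodule 0 1) two_pos (evalX₀X₁ k)
    a := CommRingCat.ofHom (Polynomial.toLaurentAlg (R := k)).toRingHom
    b := CommRingCat.ofHom ((invert (R := k)).toAlgHom.comp Polynomial.toLaurentAlg).toRingHom
    open₀ := h₀
    open₁ := h₁
    open₀₁ := h₀₁
    comp₀ := comp₀
    comp₁ := comp₁
    sup_eq := by
      refine Eq.trans ?_ (basicOpen_X_zero_sup_basicOpen_X_one (k := k))
      exact congrArg₂ (· ⊔ ·) (standardChart_image_top _ _ _ (bijective_evalX₀ k))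
        (standardChart_image_top _ _ _ (bijective_evalX₁ k))
    inf_le := by
      refine Eq.le (Eq.trans ?_ ((Proj.basicOpen_mul (homogeneousSubmodule (Fin 2) k)
        (X 0) (X 1)).symm.trans (standardChart_image_top _ _ _ (bijective_evalX₀X₁ k)).symm))
      exact congrArg₂ (· ⊓ ·) (standardChart_image_top _ _ _ (bijective_evalX₀ k))
        (standardChart_image_top _ _ _ (bijective_evalX₁ k))
    t := (Polynomial.X : Polynomial k)
    s := (Polynomial.X : Polynomial k)
    image₀ := image_top_of_range_comap comp₀ _ (range_comap_toLaurent k)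
    image₁ := image_top_of_range_comap comp₁ _ (range_comap_invert_toLaurent k)
    isUnit_a := by
      have h : IsUnit (Polynomial.toLaurent (Polynomial.X : Polynomial k)) := by
        rw [Polynomial.toLaurent_X]
        exact isUnit_T 1
      exact h
    isUnit_b := by
      have h : IsUnit (invert (Polynomial.toLaurent (Polynomial.X : Polynomial k))) := by
        rw [Polynomial.toLaurent_X]
        exact (isUnit_T 1).map invert
      exact h }

lemma isStandard_projectiveLineCharts (k : Type u) [Field k] :
    (projectiveLineCharts k).IsStandard where
  a_apply _ := rfl
  b_apply _ := rfl
  t_eq := rfl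
  s_eq := rfl

end StandardCharts

lemma isLineBundle_structureModule (X : Scheme.{u}) : IsLineBundle (structureModule X) :=
  fun _ => ⟨⊤, trivial, ⟨Scheme.Modules.restrictUnitIso (Scheme.Opens.ι ⊤)⟩⟩

end

theorem mainTheorem8 (k : Type u) [Field k] :
    IsSigmaCPureInjective (QCoh.structureSheaf (projectiveLine k)) ∧
      ∀ L : QCoh (projectiveLine k), IsLineBundle L.obj → IsSigmaCPureInjective L :=
  ⟨TwoCharts.isSigmaCPureInjective_of_isLineBundle (isStandard_projectiveLineCharts k) _
    (isLineBundle_structureModule _),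
    TwoCharts.isSigmaCPureInjective_of_isLineBundle (isStandard_projectiveLineCharts k)⟩
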